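/- Let $d\ge 1$, let $a_0>0$ and $0<L<\infty$, and write $\|f\|=(\int_{\mathbb R^d}f^2)^{1/2}$. Let $p$ be a probability density on $\mathbb R^d$ with $\|p\|_\infty\le L$, and let $X_1,\dots,X_n$ be i.i.d. with density $p$. For an estimator $\hat p$ of $p$ based on a sample of size $k$ from $p$, put $R_k(\hat p,p)=E\|\hat p-p\|^2$. For a real function $K\in L_2(\mathbb R^d)$, $h>0$ and a sample $Z_1,\dots,Z_m$, let $$\hat p_{m,h}(x)=\frac1{mh^d}\sum_{i=1}^m K\Big(\frac{Z_i-x}{h}\Big).$$ **Grid.** Let $h_0=(n\log n)^{-1/d}$, $a_n=a_0/\log n$, and define $M$ by $M-2=\max\{j\in\mathbb N: h_0(1+a_n)^j<1\}$. Let $h_j=(1+a_n)^jh_0$ for $0\le j\le M-2$, and $h_{M-1}=1$. **Splits.** Let $m=\lfloor n(1-1/\log n)\rfloor$ and $\ell=n-m$. Let $\mathbf S$ be any finite nonempty family of (non-random) splits $\mathcal S$ of $(X_1,\dots,X_n)$ into a training sample of size $m$ and a validation sample $Y_1,\dots,Y_\ell$. **Aggregates.** For $\mathcal S\in\mathbf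 S$ let $q_j=\hat p_{m,h_{j-1}}$, $j=1,\dots,M$, be computed from the training sample. The *linear aggregate* is $\tilde p^{\mathcal S}=\sum_{k}\big(\frac1\ell\sum_{i=1}^\ell\phi_k(Y_i)\big)\phi_k$, where $(\phi_k)$ is an $L_2$-orthonormal basis of the linear span of $q_1,\dots,q_M$. The *convex aggregate* is $\tilde p^{\mathcal S}=\sum_j\hat\lambda_jq_j$, where $\hat\lambda$ minimizes $$\Big\|\sum_j\lambda_jq_j\Big\|^2-\frac2\ell\sum_{i=1}^\ell\sum_j\lambda_jq_j(Y_i)$$ over $\{\lambda\in\mathbb R^M:\lambda_j\ge0,\ \sum_j\lambda_j\le1\}$. Let $\tilde p_n=\frac1{\operatorname{card}\mathbf S}\sum_{\mathcal S\in\mathbf S}\tilde p^{\mathcal S}$, where either all the $\tilde p^{\mathcal S}$ are linear aggregates or all are convex aggregates. **Theorem 5.1.** Let $\mathcal F[K]$ be the $L_2$ Fourier transform of $K$, normalized so that $\mathcal F[K](t)=\int e^{ix^Tt}K(x)\,dx$ when also $K\in L_1(\mathbb R^d)$. Assume that a version of $\mathcal F[K]$ takes values in $[0,1]$ and satisfies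 $\mathcal F[K](h't)\ge\mathcal F[K](ht)$ for all $t\in\mathbb R^d$ and $h>h'>0$. Then there are an integer $n_0\ge4$ depending only on $L$ and $\|K\|$, a constant $c_5>0$ depending only on $d$ and $a_0$, and a constant $c_6>0$ depending only on $L,\|K\|,d$ and $a_0$, such that for all $n\ge n_0$ $$R_n(\tilde p_n,p)\le\Big(1+\frac{c_5}{\log n}\Big)\inf_{h>0}R_n(\hat p_{n,h},p)+c_6\frac{(\log n)^3}{n}.$$ -/

import Mathlib

open MeasureTheory
open scoped ENNReal FourierTransform

noncomputable section

namespace KernelAggregation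

/-- The space `ℝᵈ` with its Euclidean structure and Lebesgue measure. -/
abbrev E (d : ℕ) : Type := EuclideanSpace ℝ (Fin d)

/-- The `L₂(ℝᵈ)` norm `(∫ f²)^{1/2}` of a real function. -/
def l2Norm {d : ℕ} (f : E d → ℝ) : ℝ := Real.sqrt (∫ x, (f x) ^ 2)

/-- `p` is a probability density on `ℝᵈ` with `‖p‖_∞ ≤ L`. -/
structure IsBoundedDensity {d : ℕ} (L : ℝ) (p : E d → ℝ) : Prop where
  nonneg : ∀ x, 0 ≤ p x
  integrable : Integrable p
  integral_eq_one : ∫ x, p x = 1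
  essBounded : eLpNorm p ∞ volume ≤ ENNReal.ofReal L

/-- The law of an i.i.d. sample of size `n` with common density `p`. -/
def sampleLaw {d : ℕ} (p : E d → ℝ) (n : ℕ) : Measure (Fin n → E d) :=
  Measure.pi fun _ => volume.withDensity fun x => ENNReal.ofReal (p x)

/-- The risk `R_n(p̂, p) = E ‖p̂ - p‖²` of an estimator based on a sample of size `n`. -/
def risk {d n : ℕ} (p : E d → ℝ) (est : (Fin n → E d) → E d → ℝ) : ℝ≥0∞ :=
  ∫⁻ X, ∫⁻ x, ENNReal.ofReal ((est X x - p x) ^ 2) ∂volume ∂(sampleLaw p n)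

/-- The kernel estimator `x ↦ (m hᵈ)⁻¹ ∑ᵢ K((Xᵢ - x) / h)`. -/
def kernelEstimator {d m : ℕ} (K : E d → ℝ) (h : ℝ) (X : Fin m → E d) (x : E d) : ℝ :=
  1 / ((m : ℝ) * h ^ d) * ∑ i, K (h⁻¹ • (X i - x))

/-- The `L₂` Fourier transform of a real `f ∈ L₂(ℝᵈ)`, normalized as `t ↦ ∫ e^{i⟨x,t⟩} f(x) dx`.
Mathlib's `𝓕` extends `w ↦ ∫ e^{-2πi⟨x,w⟩} f(x) dx`, whence the change of variable
`w = -t / (2π)`. The result is a representative of an almost-everywhere class. -/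
def l2Fourier {d : ℕ} (f : E d → ℝ) (hf : MemLp f 2 volume) (t : E d) : ℂ :=
  (𝓕 ((hf.ofReal (K := ℂ)).toLp (fun x => (f x : ℂ))) : Lp ℂ 2 (volume : Measure (E d)))
    (-(2 * Real.pi)⁻¹ • t)

/-- Some version `ψ` of the Fourier transform of `K` takes values in `[0, 1]` and satisfies
`ψ(h' t) ≥ ψ(h t)` for all `t` and all `h > h' > 0`. -/
def HasMonotoneFourier {d : ℕ} (K : E d → ℝ) (hK : MemLp K 2 volume) : Prop :=
  ∃ ψ : E d → ℝ, (∀ᵐ t, l2Fourier K hK t = (ψ t : ℂ)) ∧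
    (∀ t, 0 ≤ ψ t ∧ ψ t ≤ 1) ∧
    ∀ (t : E d) (h h' : ℝ), 0 < h' → h' < h → ψ (h • t) ≤ ψ (h' • t)

/-- `g` is the linear aggregate of the functions `q₁, …, q_M` built from the sample `Y`:
`g = ∑ₖ λ̂ₖ φₖ` with `λ̂ₖ = ℓ⁻¹ ∑ᵢ φₖ(Yᵢ)`, for an orthonormal basis `φ` in `L₂(ℝᵈ)` of the
linear span of `q₁, …, q_M`. -/
def IsLinearAggregate {d M l : ℕ} (q : Fin M → E d → ℝ) (Y : Fin l → E d) (g : E d → ℝ) : Prop :=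
  ∃ (M' : ℕ) (φ : Fin M' → E d → ℝ),
    (∀ k, φ k ∈ Submodule.span ℝ (Set.range q)) ∧
    (∀ k k', ∫ x, φ k x * φ k' x = if k = k' then 1 else 0) ∧
    (∀ j, ∃ ν : Fin M' → ℝ, ∀ᵐ x, q j x = ∑ k, ν k * φ k x) ∧
    g = fun x => ∑ k, (1 / (l : ℝ) * ∑ i, φ k (Y i)) * φ k x

/-- The set `Λ^M` of nonnegative weights with sum at most one. -/
def weights (M : ℕ) : Set (Fin M → ℝ) := {w | (∀ j, 0 ≤ w j) ∧ ∑ j, w j ≤ 1}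

/-- The criterion `‖q_w‖² - (2/ℓ) ∑ᵢ q_w(Yᵢ)`, where `q_w = ∑ⱼ wⱼ qⱼ`. -/
def criterion {d M l : ℕ} (q : Fin M → E d → ℝ) (Y : Fin l → E d) (w : Fin M → ℝ) : ℝ :=
  (∫ x, (∑ j, w j * q j x) ^ 2) - 2 / (l : ℝ) * ∑ i, ∑ j, w j * q j (Y i)

/-- `g` is a convex aggregate of `q₁, …, q_M` built from the sample `Y`: `g = ∑ⱼ wⱼ qⱼ` for a
minimizer `w` of the criterion over `Λ^M`. -/
def IsConvexAggregate {d M l : ℕ} (q : Fin M → E d → ℝ) (Y : Fin l → E d) (g : E d → ℝ) : Prop :=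
  ∃ w ∈ weights M, (∀ v ∈ weights M, criterion q Y w ≤ criterion q Y v) ∧
    g = fun x => ∑ j, w j * q j x

/-- The size `m = ⌊n (1 - 1 / log n)⌋` of the training sample. -/
def trainSize (n : ℕ) : ℕ := ⌊(n : ℝ) * (1 - (Real.log n)⁻¹)⌋₊

/-- A split of a sample of size `n` into a training sample of size `m` and a validation sample of
size `ℓ = n - m`. -/
abbrev Split (n : ℕ) : Type := Fin (trainSize n) ⊕ Fin (n - trainSize n) ≃ Fin n

/-- The training sample of a split. -/
def Split.train {d n : ℕ} (σ : Split n) (X : Fin n → E d) : Fin (trainSize n) → E d :=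
  fun i => X (σ (Sum.inl i))

/-- The validation sample of a split. -/
def Split.valid {d n : ℕ} (σ : Split n) (X : Fin n → E d) : Fin (n - trainSize n) → E d :=
  fun i => X (σ (Sum.inr i))

/-- The smallest bandwidth `h₀ = (n log n)^{-1/d}`. -/
def minBandwidth (d n : ℕ) : ℝ := ((n : ℝ) * Real.log n) ^ (-(1 / (d : ℝ)))

/-- The growth rate `a_n = a₀ / log n` of the grid. -/
def gridStep (a₀ : ℝ) (n : ℕ) : ℝ := a₀ / Real.log n

/-- The size `M` of the grid, given by `M - 2 = max {j : h₀ (1 + a_n)^j < 1}`. -/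
def gridSize (d : ℕ) (a₀ : ℝ) (n : ℕ) : ℕ :=
  sSup {j : ℕ | minBandwidth d n * (1 + gridStep a₀ n) ^ j < 1} + 2

/-- The grid `h_j = (1 + a_n)^j h₀` for `0 ≤ j ≤ M - 2`, and `h_{M-1} = 1`. -/
def bandwidth (d : ℕ) (a₀ : ℝ) (n : ℕ) (j : Fin (gridSize d a₀ n)) : ℝ :=
  if (j : ℕ) + 1 = gridSize d a₀ n then 1
  else (1 + gridStep a₀ n) ^ (j : ℕ) * minBandwidth d n

/-- The initial estimators of a split: the kernel estimators with all bandwidths of the grid, based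
on the training sample. -/
def initialEstimators {d n : ℕ} (K : E d → ℝ) (a₀ : ℝ) (σ : Split n) (X : Fin n → E d)
    (j : Fin (gridSize d a₀ n)) : E d → ℝ :=
  kernelEstimator K (bandwidth d a₀ n j) (σ.train X)

/-- The average of the estimators `g σ` over a family of splits. -/
def averaged {d n : ℕ} (S : Finset (Split n)) (g : Split n → (Fin n → E d) → E d → ℝ)
    (X : Fin n → E d) (x : E d) : ℝ :=
  1 / (S.card : ℝ) * ∑ σ ∈ S, g σ X x

end KernelAggregation

end

open KernelAggregation

/-! The bound combines two estimates: for a fixed training sample, aggregating costs at most `L * M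
/ ℓ` beyond the loss of any single `q_j`; and some grid bandwidth used with `m` observations is
nearly as good as any given `h` used with `n`.

Aggregation. Let `b` be an orthonormal basis of the span of the `q_j` in `L₂`. For almost every
validation sample, the empirical mean on this span is the inner product with `G₀ = ∑ₖ empMean (b k)
• b k`, an unbiased estimate of the orthogonal projection `P'` of `p`. Both aggregates are
projections of `G₀`, onto the span or onto a convex subset, and the variational inequality gives `‖g
- p‖² ≤ ‖q_j - p‖² + ‖G₀ - P'‖²` (`norm_sub_sq_le_of_inner_nonpos`). The last term has as mean a sum
of at most `M` variances, each at most `L / ℓ` because `p ≤ L` (`lintegral_aggregate_le`). As `M =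
O(log² n)` and `ℓ ≥ n / log n`, the price is of order `log³ n / n`. The convexity of the squared
loss carries the bound over to the average over splits.

Bandwidth. With `k` observations the risk at `h` is exactly `B(h) + (‖K‖² / hᵈ - s(h)) / k`, where
`B` is the squared bias and `s` the squared norm of the mean. By Plancherel both are integrals
against `|𝓕 p|²`, with multipliers `(1 - χ(h v))²` and `χ(h v)²` (`exists_spectral_representation`).
Hence `B` is nondecreasing in `h`, `s` is nonincreasing, and `s ≤ ‖p‖² ≤ L`. For `h₀ ≤ h ≤ 1`,
moving to a nearby grid point below `h` does not increase the bias and inflates `‖K‖² / (n hᵈ)` by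
at most `(1 + a_n)ᵈ n / m = 1 + O(1 / log n)`. Other bandwidths are compared with `1`: above it the
bias is no smaller, while the variance at `1` is `O(1 / n)`; below `h₀` the risk is at least `‖K‖²
log n - L`, which for large `n` exceeds the risk at `1`. -/

namespace KernelAggregation

/-! ### The `L₂` Fourier transform, tested against Schwartz functions -/

section

open SchwartzMap

/-- The `L₂` Fourier transform is self-adjoint against Schwartz functions. -/
theorem integral_schwartz_mul_fourier {d : ℕ} (f : Lp ℂ 2 (volume : Measure (E d)))
    (g : 𝓢(E d, ℂ)) : ∫ x, g x * (𝓕 f : Lp ℂ 2 (volume : Measure (E d))) x = ∫ x, 𝓕 g x * f x := by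
  have h := Lp.fourier_toTemperedDistribution_eq f
  have h2 := DFunLike.congr_fun h g
  rw [TemperedDistribution.fourier_apply, Lp.toTemperedDistribution_apply,
    Lp.toTemperedDistribution_apply] at h2
  simpa [smul_eq_mul] using h2.symm

/-- A locally integrable function which is weakly the Fourier transform of `f` is the `L₂` Fourier
transform of `f`. -/
theorem fourier_ae_eq_of_forall_integral_eq {d : ℕ} (f : Lp ℂ 2 (volume : Measure (E d)))
    {H : E d → ℂ} (hH : LocallyIntegrable H)
    (h : ∀ g : 𝓢(E d, ℂ), ∫ x, g x * H x = ∫ x, 𝓕 g x * f x) :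
    (𝓕 f : Lp ℂ 2 (volume : Measure (E d))) =ᵐ[volume] H := by
  apply ae_eq_of_integral_contDiff_smul_eq
  · exact (Lp.memLp _).locallyIntegrable (by norm_num)
  · exact hH
  · intro g g_smooth g_cpt
    have hg₁ : HasCompactSupport (Complex.ofRealCLM ∘ g) := g_cpt.comp_left rfl
    have hg₂ : ContDiff ℝ (⊤ : ℕ∞) (Complex.ofRealCLM ∘ g) :=
      Complex.ofRealCLM.contDiff.comp g_smooth
    have h1 := integral_schwartz_mul_fourier f (hg₁.toSchwartzMap hg₂)
    have h2 := h (hg₁.toSchwartzMap hg₂)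
    rw [← h2] at h1
    simpa using h1

/-- The `L₂` Fourier transform agrees with the Fourier integral on `L₁ ∩ L₂`. -/
theorem fourier_toLp_ae_eq {d : ℕ} {f : E d → ℂ} (hf : Integrable f) (hf2 : MemLp f 2) :
    (𝓕 (hf2.toLp f) : Lp ℂ 2 (volume : Measure (E d))) =ᵐ[volume] 𝓕 f := by
  have hcont : Continuous (𝓕 f) :=
    VectorFourier.fourierIntegral_continuous Real.continuous_fourierChar
      (by exact continuous_inner) hf
  apply fourier_ae_eq_of_forall_integral_eq _ hcont.locallyIntegrable
  intro g
  have h1 : ∫ x, 𝓕 g x * (hf2.toLp f) x = ∫ x, 𝓕 g x * f x := by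
    apply integral_congr_ae
    filter_upwards [hf2.coeFn_toLp] with x hx
    rw [hx]
  rw [h1]
  have h2 := VectorFourier.integral_fourierIntegral_smul_eq_flip (L := innerₗ (E d))
    (μ := volume) (ν := volume) (f := (g : E d → ℂ)) (g := f)
    Real.continuous_fourierChar continuous_inner g.integrable hf
  simp only [flip_innerₗ] at h2
  exact h2.symm

theorem integral_comp_sub_smul {d : ℕ} (Φ : E d → ℂ) (y : E d) {h : ℝ} (hh : 0 < h) :
    ∫ u, Φ (y - h • u) = ((h ^ d)⁻¹ : ℝ) • ∫ x, Φ x := by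
  rw [Measure.integral_comp_smul volume (fun x => Φ (y - x)) h, integral_sub_left_eq_self,
    finrank_euclideanSpace_fin, abs_of_pos (by positivity)]

theorem integral_comp_neg_smul {d : ℕ} (Φ : E d → ℂ) {h : ℝ} (hh : 0 < h) :
    ∫ u, Φ (-(h • u)) = ((h ^ d)⁻¹ : ℝ) • ∫ x, Φ x := by
  simpa using integral_comp_sub_smul Φ 0 hh

open Real in
/-- The Fourier multiplier of a dilation followed by a translation, tested on a Schwartz
function. -/
theorem integral_fourier_comp_affine_mul {d : ℕ} (f : Lp ℂ 2 (volume : Measure (E d)))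
    (g : 𝓢(E d, ℂ)) (y : E d) {h : ℝ} (hh : 0 < h) :
    ∫ u, 𝓕 g (y - h • u) * f u =
      ∫ v, 𝐞 (-inner ℝ y v) • (g v * (𝓕 f : Lp ℂ 2 (volume : Measure (E d))) (-(h • v))) := by
  let e : E d ≃L[ℝ] E d := ContinuousLinearEquiv.smulLeft (Units.mk0 (-h) (by linarith [hh]))
  -- The map `u ↦ 𝓕 g (y - h • u)` is itself a Schwartz function, hence the Fourier transform of a
  -- Schwartz function `G`. Self-adjointness then moves the transform from `G` to `f`.
  let G' : 𝓢(E d, ℂ) := compCLMOfContinuousLinearEquiv ℂ e (compSubConstCLM ℂ (-y) (𝓕 g))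
  have hG' : ∀ u, G' u = 𝓕 g (y - h • u) := by
    intro u
    simp only [G', compCLMOfContinuousLinearEquiv_apply, Function.comp_apply,
      compSubConstCLM_apply]
    congr 1
    simp [e, Units.smul_def]
    abel
  let G : 𝓢(E d, ℂ) := 𝓕⁻ G'
  have hG : ∀ v, G (-(h • v)) = ((h ^ d)⁻¹ : ℝ) • (𝐞 (-inner ℝ y v) • g v) := by
    intro v
    change (𝓕⁻ G' : 𝓢(E d, ℂ)) _ = _
    rw [fourierInv_coe, Real.fourierInv_eq]
    let Φ : E d → ℂ := fun x => 𝐞 (inner ℝ (x - y) v) • 𝓕 g x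
    have : ∀ u, 𝐞 (inner ℝ u (-(h • v))) • G' u = Φ (y - h • u) := by
      intro u
      simp only [Φ, hG']
      congr 2
      simp [inner_smul_left, inner_smul_right]
    simp_rw [this]
    rw [integral_comp_sub_smul Φ y hh]
    congr 1
    have h3 : g v = 𝓕⁻ (𝓕 g) v := by simp
    rw [h3, fourierInv_coe, Real.fourierInv_eq, Circle.smul_def, ← integral_smul]
    congr 1
    ext x
    simp only [Φ]
    rw [show inner ℝ (x - y) v = -inner ℝ y v + inner ℝ x v by rw [inner_sub_left]; ring,
      AddChar.map_add_eq_mul, mul_smul, Circle.smul_def]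
  have h1 : ∫ u, 𝓕 g (y - h • u) * f u = ∫ u, 𝓕 G u * f u := by
    simp [G, hG']
  rw [h1, ← integral_schwartz_mul_fourier]
  have h2 := integral_comp_neg_smul
    (fun w => G w * (𝓕 f : Lp ℂ 2 (volume : Measure (E d))) w) hh
  have hd : (h ^ d : ℝ) ≠ 0 := by positivity
  rw [show (∫ x, G x * (𝓕 f : Lp ℂ 2 (volume : Measure (E d))) x) =
    (h ^ d : ℝ) • ((h ^ d)⁻¹ : ℝ) • ∫ x, G x * (𝓕 f : Lp ℂ 2 (volume : Measure (E d))) x by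
      rw [smul_smul, mul_inv_cancel₀ hd, one_smul], ← h2, ← integral_smul]
  congr 1
  ext v
  rw [hG, smul_mul_assoc, smul_smul, mul_inv_cancel₀ hd, one_smul, smul_mul_assoc]

end

/-! ### Means of kernel estimators and their Fourier transforms -/

section

/-- The distribution with density `p`. -/
noncomputable def law {d : ℕ} (p : E d → ℝ) : Measure (E d) :=
  volume.withDensity fun x => ENNReal.ofReal (p x)

theorem sampleLaw_eq {d : ℕ} (p : E d → ℝ) (n : ℕ) :
    sampleLaw p n = Measure.pi fun _ => law p := rfl

namespace IsBoundedDensity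

variable {d : ℕ} {L : ℝ} {p : E d → ℝ}

theorem isProbabilityMeasure (hp : IsBoundedDensity L p) : IsProbabilityMeasure (law p) := by
  constructor
  rw [law, withDensity_apply _ MeasurableSet.univ, Measure.restrict_univ,
    ← ofReal_integral_eq_lintegral_ofReal hp.integrable (Filter.Eventually.of_forall hp.nonneg),
    hp.integral_eq_one, ENNReal.ofReal_one]

theorem law_absolutelyContinuous (p : E d → ℝ) : law p ≪ volume :=
  withDensity_absolutelyContinuous _ _

theorem ae_le (hp : IsBoundedDensity L p) (hL : 0 ≤ L) : ∀ᵐ x, p x ≤ L := by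
  have h := ae_le_eLpNormEssSup (f := p) (μ := volume)
  filter_upwards [h] with x hx
  have h1 := hx.trans (by simpa using hp.essBounded)
  rw [Real.enorm_eq_ofReal (hp.nonneg x)] at h1
  exact (ENNReal.ofReal_le_ofReal_iff hL).1 h1

theorem law_le (hp : IsBoundedDensity L p) (hL : 0 ≤ L) :
    law p ≤ ENNReal.ofReal L • volume := by
  rw [law, ← withDensity_const]
  refine withDensity_mono ?_
  filter_upwards [hp.ae_le hL] with x hx
  exact ENNReal.ofReal_le_ofReal hx

theorem memLp_law (hp : IsBoundedDensity L p) (hL : 0 ≤ L) {f : E d → ℝ} (hf : MemLp f 2) :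
    MemLp f 2 (law p) :=
  hf.of_measure_le_smul ENNReal.ofReal_ne_top (hp.law_le hL)

theorem integral_law (hp : IsBoundedDensity L p) {F : Type*} [NormedAddCommGroup F]
    [NormedSpace ℝ F] (f : E d → F) : ∫ x, f x ∂(law p) = ∫ x, p x • f x := by
  rw [law, integral_withDensity_eq_integral_toReal_smul₀
    hp.integrable.aestronglyMeasurable.aemeasurable.ennreal_ofReal
    (Filter.Eventually.of_forall fun _ => ENNReal.ofReal_lt_top)]
  simp_rw [ENNReal.toReal_ofReal (hp.nonneg _)]

/-- Applied to a unit vector of `L₂`, this bounds the variance of one empirical coefficient by `L /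
ℓ`. -/
theorem integral_sq_law_le (hp : IsBoundedDensity L p) (hL : 0 ≤ L) {f : E d → ℝ}
    (hf : MemLp f 2) : ∫ x, f x ^ 2 ∂(law p) ≤ L * ∫ x, f x ^ 2 := by
  have h := integral_mono_measure (f := fun x => f x ^ 2) (hp.law_le hL)
    (Filter.Eventually.of_forall fun x => sq_nonneg (f x))
    (hf.integrable_sq.smul_measure ENNReal.ofReal_ne_top)
  rwa [integral_smul_measure, ENNReal.toReal_ofReal hL, smul_eq_mul] at h

theorem memLp_two (hp : IsBoundedDensity L p) (hL : 0 ≤ L) : MemLp p 2 := by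
  rw [memLp_two_iff_integrable_sq hp.integrable.aestronglyMeasurable]
  refine (hp.integrable.const_mul L).mono' (hp.integrable.aestronglyMeasurable.pow 2) ?_
  filter_upwards [hp.ae_le hL] with x hx
  rw [Real.norm_of_nonneg (sq_nonneg _), sq]
  exact mul_le_mul_of_nonneg_right hx (hp.nonneg x)

theorem integral_sq_le (hp : IsBoundedDensity L p) (hL : 0 ≤ L) : ∫ x, p x ^ 2 ≤ L := by
  have h : ∫ x, p x ^ 2 ≤ ∫ x, L * p x := by
    refine integral_mono_ae (hp.memLp_two hL).integrable_sq (hp.integrable.const_mul L) ?_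
    filter_upwards [hp.ae_le hL] with x hx
    simp only [sq]
    exact mul_le_mul_of_nonneg_right hx (hp.nonneg x)
  rwa [integral_const_mul, hp.integral_eq_one, mul_one] at h

end IsBoundedDensity

/-- The rescaled kernel `u ↦ h⁻ᵈ K(u / h)`. -/
noncomputable def dilate {d : ℕ} (K : E d → ℝ) (h : ℝ) (u : E d) : ℝ := (h ^ d)⁻¹ * K (h⁻¹ • u)

/-- The mean `x ↦ E φ(X - x)` of a kernel estimator with (rescaled) kernel `φ`. -/
noncomputable def smooth {d : ℕ} (φ p : E d → ℝ) (x : E d) : ℝ := ∫ y, φ (y - x) ∂(law p)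

section

variable {d : ℕ} {L : ℝ} {p φ : E d → ℝ}

theorem memLp_comp_sub {φ : E d → ℝ} (hφ : MemLp φ 2) (x : E d) :
    MemLp (fun y => φ (y - x)) 2 :=
  hφ.comp_measurePreserving (measurePreserving_sub_right volume x)

theorem memLp_comp_sub_left {φ : E d → ℝ} (hφ : MemLp φ 2) (y : E d) :
    MemLp (fun x => φ (y - x)) 2 :=
  hφ.comp_measurePreserving (volume.measurePreserving_sub_left y)

theorem quasiMeasurePreserving_smul {h : ℝ} (hh : h ≠ 0) :
    Measure.QuasiMeasurePreserving (fun x : E d => h • x) volume volume := by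
  refine ⟨measurable_const_smul h, ?_⟩
  rw [Measure.map_addHaar_smul _ hh]
  exact Measure.smul_absolutelyContinuous

theorem memLp_comp_smul {F : Type*} [NormedAddCommGroup F] {f : E d → F} (hf : MemLp f 2)
    {h : ℝ} (hh : h ≠ 0) : MemLp (fun x => f (h • x)) 2 := by
  have h1 : MemLp f 2 (Measure.map (fun x : E d => h • x) volume) := by
    rw [Measure.map_addHaar_smul _ hh]
    exact hf.smul_measure ENNReal.ofReal_ne_top
  exact (memLp_map_measure_iff h1.1 (measurable_const_smul h).aemeasurable).1 h1

theorem memLp_dilate {K : E d → ℝ} (hK : MemLp K 2) {h : ℝ} (hh : 0 < h) :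
    MemLp (dilate K h) 2 :=
  (memLp_comp_smul hK (inv_ne_zero hh.ne')).const_mul _

theorem integral_dilate_sq (K : E d → ℝ) {h : ℝ} (hh : 0 < h) :
    ∫ x, dilate K h x ^ 2 = l2Norm K ^ 2 / h ^ d := by
  rw [l2Norm, Real.sq_sqrt (integral_nonneg fun x => sq_nonneg _)]
  simp only [dilate, mul_pow]
  rw [integral_const_mul, Measure.integral_comp_smul volume (fun x => K x ^ 2),
    finrank_euclideanSpace_fin, abs_of_pos (by positivity), smul_eq_mul]
  have : h ^ d ≠ 0 := by positivity
  rw [inv_pow h d, inv_inv]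
  field_simp

theorem kernelEstimator_eq {m : ℕ} (K : E d → ℝ) (h : ℝ) (X : Fin m → E d) (x : E d) :
    kernelEstimator K h X x = 1 / (m : ℝ) * ∑ i, dilate K h (X i - x) := by
  simp only [kernelEstimator, dilate, ← Finset.mul_sum]
  rw [one_div, mul_inv, one_div, mul_assoc]

/-- The kernel is only almost everywhere measurable. Composition is still harmless, because
subtraction pulls null sets back to null sets and the sampling law is absolutely continuous. -/
theorem aestronglyMeasurable_comp_sub (hp : IsBoundedDensity L p) (hφ : MemLp φ 2) :
    AEStronglyMeasurable (fun z : E d × E d => φ (z.2 - z.1)) (volume.prod (law p)) := by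
  have := hp.isProbabilityMeasure
  have h1 : Measure.QuasiMeasurePreserving (fun z : E d × E d => z.2 - z.1)
      (volume.prod volume) volume := by
    have := (quasiMeasurePreserving_sub_of_right_invariant (volume : Measure (E d)) volume).comp
      (Measure.measurePreserving_swap (μ := (volume : Measure (E d))) (ν := volume)).quasiMeasurePreserving
    exact this
  exact (hφ.1.comp_quasiMeasurePreserving h1).mono_ac
    (Measure.AbsolutelyContinuous.rfl.prod (IsBoundedDensity.law_absolutelyContinuous p))

theorem integrable_comp_sub_sq (hp : IsBoundedDensity L p) (hφ : MemLp φ 2) :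
    Integrable (fun z : E d × E d => φ (z.2 - z.1) ^ 2) (volume.prod (law p)) := by
  have := hp.isProbabilityMeasure
  refine (integrable_prod_iff' ((aestronglyMeasurable_comp_sub hp hφ).pow 2)).2 ?_
  refine ⟨Filter.Eventually.of_forall fun y => (memLp_comp_sub_left hφ y).integrable_sq, ?_⟩
  have : (fun y => ∫ x, ‖φ (y - x) ^ 2‖) = fun _ => ∫ x, φ x ^ 2 := by
    ext y
    simp_rw [norm_pow, Real.norm_eq_abs, sq_abs]
    exact integral_sub_left_eq_self (fun x => φ x ^ 2) volume y
  exact this ▸ integrable_const _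

theorem memLp_comp_sub_prod (hp : IsBoundedDensity L p) (hφ : MemLp φ 2) :
    MemLp (fun z : E d × E d => φ (z.2 - z.1)) 2 (volume.prod (law p)) :=
  (memLp_two_iff_integrable_sq (aestronglyMeasurable_comp_sub hp hφ)).2
    (integrable_comp_sub_sq hp hφ)

/-- The mean square `x ↦ E φ(X - x)²` integrates to `‖φ‖²`. -/
theorem integral_integral_comp_sub_sq (hp : IsBoundedDensity L p) (hφ : MemLp φ 2) :
    ∫ x, ∫ y, φ (y - x) ^ 2 ∂(law p) = ∫ x, φ x ^ 2 := by
  have := hp.isProbabilityMeasure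
  rw [integral_integral_swap (integrable_comp_sub_sq hp hφ)]
  simp [fun y => integral_sub_left_eq_self (fun x => φ x ^ 2) volume y]

theorem integrable_integral_comp_sub_sq (hp : IsBoundedDensity L p) (hφ : MemLp φ 2) :
    Integrable (fun x => ∫ y, φ (y - x) ^ 2 ∂(law p)) := by
  have := hp.isProbabilityMeasure
  exact (integrable_comp_sub_sq hp hφ).integral_prod_left

theorem sq_integral_le_integral_sq {Ω : Type*} {m : MeasurableSpace Ω} (μ : Measure Ω)
    [IsProbabilityMeasure μ] {f : Ω → ℝ} (hf : MemLp f 2 μ) :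
    (∫ x, f x ∂μ) ^ 2 ≤ ∫ x, f x ^ 2 ∂μ := by
  have h1 := ProbabilityTheory.variance_nonneg f μ
  rw [ProbabilityTheory.variance_eq_sub hf] at h1
  simpa using h1

theorem smooth_sq_le (hp : IsBoundedDensity L p) (hL : 0 ≤ L) (hφ : MemLp φ 2) (x : E d) :
    smooth φ p x ^ 2 ≤ ∫ y, φ (y - x) ^ 2 ∂(law p) := by
  have := hp.isProbabilityMeasure
  exact sq_integral_le_integral_sq _ (hp.memLp_law hL (memLp_comp_sub hφ x))

theorem memLp_smooth (hp : IsBoundedDensity L p) (hL : 0 ≤ L) (hφ : MemLp φ 2) :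
    MemLp (smooth φ p) 2 := by
  have := hp.isProbabilityMeasure
  have hm : AEStronglyMeasurable (smooth φ p) volume :=
    (aestronglyMeasurable_comp_sub hp hφ).integral_prod_right'
  rw [memLp_two_iff_integrable_sq hm]
  refine (integrable_integral_comp_sub_sq hp hφ).mono' (hm.pow 2)
    (Filter.Eventually.of_forall fun x => ?_)
  rw [Real.norm_of_nonneg (sq_nonneg _)]
  exact smooth_sq_le hp hL hφ x

theorem integral_smooth_sq_le (hp : IsBoundedDensity L p) (hL : 0 ≤ L) (hφ : MemLp φ 2) :
    ∫ x, smooth φ p x ^ 2 ≤ ∫ x, φ x ^ 2 := by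
  rw [← integral_integral_comp_sub_sq hp hφ]
  exact integral_mono (memLp_smooth hp hL hφ).integrable_sq
    (integrable_integral_comp_sub_sq hp hφ) (smooth_sq_le hp hL hφ)

end

open SchwartzMap Real in
/-- The Fourier transform of the mean of a kernel estimator is a product. -/
theorem fourier_smooth_ae_eq {d : ℕ} {L : ℝ} {p K : E d → ℝ} (hp : IsBoundedDensity L p)
    (hL : 0 ≤ L) (hK : MemLp K 2) {h : ℝ} (hh : 0 < h) :
    (𝓕 ((memLp_smooth hp hL (memLp_dilate hK hh)).ofReal (K := ℂ)).toLp :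
      Lp ℂ 2 (volume : Measure (E d))) =ᵐ[volume]
    fun v => (𝓕 ((hK.ofReal (K := ℂ)).toLp) : Lp ℂ 2 (volume : Measure (E d))) (-(h • v)) *
      𝓕 (fun x => (p x : ℂ)) v := by
  have := hp.isProbabilityMeasure
  set φ := dilate K h with hφdef
  have hφ : MemLp φ 2 := memLp_dilate hK hh
  set F' : Lp ℂ 2 (volume : Measure (E d)) := 𝓕 ((hK.ofReal (K := ℂ)).toLp) with hF'
  set F : E d → ℂ := ⇑F' with hF
  have hFm : MemLp F 2 := Lp.memLp _
  have hFh : MemLp (fun v => F (-(h • v))) 2 := by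
    simpa using memLp_comp_smul hFm (neg_ne_zero.2 hh.ne')
  -- As a characteristic function, `𝓕 p` is bounded by `1`, which keeps the product with the kernel
  -- transform in `L₂`. It is also a mean over `y`, so that Fubini applies under `law p`.
  have hchar : ∀ v, 𝓕 (fun x => (p x : ℂ)) v = ∫ y, (𝐞 (-inner ℝ y v) • (1 : ℂ)) ∂(law p) := by
    intro v
    rw [Real.fourier_eq, hp.integral_law]
    congr 1
    ext y
    simp [Circle.smul_def, mul_comm]
  have hcont : Continuous (𝓕 (fun x => (p x : ℂ))) :=
    VectorFourier.fourierIntegral_continuous Real.continuous_fourierChar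
      (by exact continuous_inner) hp.integrable.ofReal
  have hbound : ∀ v, ‖𝓕 (fun x => (p x : ℂ)) v‖ ≤ 1 := by
    intro v
    rw [hchar]
    refine (norm_integral_le_of_norm_le_const (C := 1) (Filter.Eventually.of_forall fun y => ?_)).trans ?_
    · simp
    · simp
  have hHm : MemLp (fun v => F (-(h • v)) * 𝓕 (fun x => (p x : ℂ)) v) 2 := by
    refine hFh.of_le (hFh.1.mul hcont.aestronglyMeasurable) (Filter.Eventually.of_forall fun v => ?_)
    rw [norm_mul]
    exact mul_le_of_le_one_right (norm_nonneg _) (hbound v)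
  apply fourier_ae_eq_of_forall_integral_eq _ (hHm.locallyIntegrable (by norm_num))
  intro g
  have hint1 : Integrable (fun z : E d × E d =>
      𝐞 (-inner ℝ z.2 z.1) • (g z.1 * F (-(h • z.1)))) (volume.prod (law p)) := by
    have h1 : Integrable (fun v => g v * F (-(h • v))) :=
      MemLp.integrable_mul (g.memLp 2 volume) hFh
    have h2 := h1.comp_fst (law p)
    refine h2.mono ?_ (Filter.Eventually.of_forall fun z => by simp)
    have h3 : Continuous fun z : E d × E d => -(inner ℝ z.2 z.1) :=
      (continuous_snd.inner continuous_fst).neg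
    exact ((continuous_induced_dom.comp (Real.continuous_fourierChar.comp h3)).aestronglyMeasurable).mul
      h2.1
  have hint2 : Integrable (fun z : E d × E d => 𝓕 g z.1 * (φ (z.2 - z.1) : ℂ))
      (volume.prod (law p)) := by
    have h1 : MemLp (fun z : E d × E d => 𝓕 g z.1) 2 (volume.prod (law p)) :=
      ((𝓕 g).memLp 2 volume).comp_fst (law p)
    exact h1.integrable_mul ((memLp_comp_sub_prod hp hφ).ofReal (K := ℂ))
  -- Fubini reduces the claim to a fixed observation `y`, where it is the formula for a dilated and
  -- translated kernel. A second use of Fubini restores the mean.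
  calc ∫ v, g v * (F (-(h • v)) * 𝓕 (fun x => (p x : ℂ)) v)
      = ∫ v, ∫ y, 𝐞 (-inner ℝ y v) • (g v * F (-(h • v))) ∂(law p) := by
        congr 1
        ext v
        rw [hchar, ← mul_assoc, ← integral_const_mul]
        congr 1
        ext y
        simp [Circle.smul_def, mul_comm]
    _ = ∫ y, ∫ v, 𝐞 (-inner ℝ y v) • (g v * F (-(h • v))) ∂volume ∂(law p) :=
        integral_integral_swap hint1
    _ = ∫ y, ∫ x, 𝓕 g x * (φ (y - x) : ℂ) ∂volume ∂(law p) := by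
        congr 1
        ext y
        rw [← integral_fourier_comp_affine_mul _ g y hh]
        have h3 := integral_comp_sub_smul (fun x => 𝓕 g x * (φ (y - x) : ℂ)) y hh
        have hd : (h ^ d : ℝ) ≠ 0 := by positivity
        rw [← one_smul ℝ (∫ x, 𝓕 g x * (φ (y - x) : ℂ)), ← mul_inv_cancel₀ hd, mul_smul, ← h3,
          ← integral_smul]
        apply integral_congr_ae
        filter_upwards [(hK.ofReal (K := ℂ)).coeFn_toLp] with u hu
        rw [hu, hφdef, dilate, sub_sub_cancel, smul_smul, inv_mul_cancel₀ hh.ne', one_smul]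
        simp only [Complex.real_smul]
        push_cast
        have : (h : ℂ) ^ d ≠ 0 := by exact_mod_cast hd
        field_simp
        rfl
    _ = ∫ x, ∫ y, 𝓕 g x * (φ (y - x) : ℂ) ∂(law p) := (integral_integral_swap hint2).symm
    _ = _ := by
        apply integral_congr_ae
        filter_upwards [((memLp_smooth hp hL hφ).ofReal (K := ℂ)).coeFn_toLp] with x hx
        rw [hx, integral_const_mul]
        exact congrArg _ integral_ofReal

end

/-! ### Plancherel and monotonicity of bias and mean in the bandwidth -/

section

theorem integrable_norm_sq_of_ae_eq {d : ℕ} (g : Lp ℂ 2 (volume : Measure (E d))) {w : E d → ℝ}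
    (hw : (fun v => ‖g v‖ ^ 2) =ᵐ[volume] w) : Integrable w :=
  ((memLp_two_iff_integrable_sq_norm (Lp.memLp g).1).1 (Lp.memLp g)).congr hw

/-- Plancherel's formula for a real square integrable function. -/
theorem integral_sq_eq_integral_norm_fourier_sq {d : ℕ} {f : E d → ℝ} (hf : MemLp f 2) :
    ∫ x, f x ^ 2 =
      ∫ v, ‖(𝓕 ((hf.ofReal (K := ℂ)).toLp) : Lp ℂ 2 (volume : Measure (E d))) v‖ ^ 2 := by
  have key : ∀ g : Lp ℂ 2 (volume : Measure (E d)), ‖g‖ ^ 2 = ∫ v, ‖g v‖ ^ 2 := by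
    intro g
    have h1 : (inner ℂ g g) = ∫ v, inner ℂ (g v) (g v) := L2.inner_def g g
    rw [inner_self_eq_norm_sq_to_K] at h1
    simp_rw [inner_self_eq_norm_sq_to_K] at h1
    have h2 : ∫ v, ((‖g v‖ : ℂ)) ^ 2 = ((∫ v, ‖g v‖ ^ 2 : ℝ) : ℂ) := by
      rw [← integral_complex_ofReal]
      simp
    have h3 : ((‖g‖ ^ 2 : ℝ) : ℂ) = ((∫ v, ‖g v‖ ^ 2 : ℝ) : ℂ) := by
      rw [← h2]
      push_cast
      exact h1
    exact_mod_cast h3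
  rw [← key, Lp.norm_fourier_eq, key]
  apply integral_congr_ae
  filter_upwards [(hf.ofReal (K := ℂ)).coeFn_toLp] with x hx
  rw [hx]
  simp

/-- The factor `2π` between the two normalizations is absorbed into the argument of `ψ`. The
exceptional null set may depend on `h`, since each dilation preserves null sets separately. -/
theorem HasMonotoneFourier.exists_multiplier {d : ℕ} {K : E d → ℝ} {hK : MemLp K 2 volume}
    (hF : HasMonotoneFourier K hK) :
    ∃ χ : E d → ℝ, (∀ h : ℝ, 0 < h → ∀ᵐ v,
        (𝓕 ((hK.ofReal (K := ℂ)).toLp) : Lp ℂ 2 (volume : Measure (E d))) (-(h • v)) =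
          (χ (h • v) : ℂ)) ∧
      (∀ v, 0 ≤ χ v ∧ χ v ≤ 1) ∧
      ∀ (v : E d) (h h' : ℝ), 0 < h' → h' ≤ h → χ (h • v) ≤ χ (h' • v) := by
  obtain ⟨ψ, h1, h2, h3⟩ := hF
  have hpi : (2 * Real.pi) ≠ 0 := by positivity
  refine ⟨fun v => ψ ((2 * Real.pi) • v), fun h hh => ?_, fun v => h2 _, fun v h h' hh' hle => ?_⟩
  · have := (quasiMeasurePreserving_smul (d := d) (h := 2 * Real.pi * h) (by positivity)).ae h1
    filter_upwards [this] with v hv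
    rw [smul_smul, ← hv, l2Fourier, smul_smul]
    congr 1
    rw [neg_mul, inv_mul_cancel_left₀ hpi, neg_smul]
  · rcases hle.eq_or_lt with rfl | hlt
    · exact le_rfl
    · have := h3 ((2 * Real.pi) • v) h h' hh' hlt
      rwa [smul_comm, smul_comm h'] at this

section

variable {d : ℕ} {L : ℝ} {p K : E d → ℝ}

/-- The bias and the mean of the kernel estimators in the frequency domain. -/
theorem exists_spectral_representation (hp : IsBoundedDensity L p) (hL : 0 ≤ L)
    (hK : MemLp K 2) (hF : HasMonotoneFourier K hK) :
    ∃ (χ A : E d → ℝ), (∀ v, 0 ≤ χ v ∧ χ v ≤ 1) ∧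
      (∀ (v : E d) (h h' : ℝ), 0 < h' → h' ≤ h → χ (h • v) ≤ χ (h' • v)) ∧
      (∀ v, 0 ≤ A v) ∧ Integrable A ∧ ∫ x, p x ^ 2 = ∫ v, A v ∧
      (∀ h, 0 < h → Integrable (fun v => χ (h • v) ^ 2 * A v) ∧
        ∫ x, smooth (dilate K h) p x ^ 2 = ∫ v, χ (h • v) ^ 2 * A v) ∧
      (∀ h, 0 < h → Integrable (fun v => (1 - χ (h • v)) ^ 2 * A v) ∧
        ∫ x, (smooth (dilate K h) p x - p x) ^ 2 = ∫ v, (1 - χ (h • v)) ^ 2 * A v) := by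
  obtain ⟨χ, hχ, hχ01, hmono⟩ := hF.exists_multiplier
  have hp2 := hp.memLp_two hL
  have hpF := fourier_toLp_ae_eq hp.integrable.ofReal (hp2.ofReal (K := ℂ))
  have hA : (fun v => ‖(𝓕 ((hp2.ofReal (K := ℂ)).toLp) : Lp ℂ 2 (volume : Measure (E d))) v‖ ^ 2)
      =ᵐ[volume] fun v => ‖𝓕 (fun x => (p x : ℂ)) v‖ ^ 2 := by
    filter_upwards [hpF] with v hv
    rw [hv]
    rfl
  refine ⟨χ, fun v => ‖𝓕 (fun x => (p x : ℂ)) v‖ ^ 2, hχ01, hmono, fun v => by positivity,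
    integrable_norm_sq_of_ae_eq _ hA, ?_, fun h hh => ?_, fun h hh => ?_⟩
  · rw [integral_sq_eq_integral_norm_fourier_sq hp2]
    exact integral_congr_ae hA
  · have hs := memLp_smooth hp hL (memLp_dilate hK hh)
    have h1 : (fun v => ‖(𝓕 ((hs.ofReal (K := ℂ)).toLp) :
        Lp ℂ 2 (volume : Measure (E d))) v‖ ^ 2) =ᵐ[volume]
        fun v => χ (h • v) ^ 2 * ‖𝓕 (fun x => (p x : ℂ)) v‖ ^ 2 := by
      filter_upwards [fourier_smooth_ae_eq hp hL hK hh, hχ h hh] with v hv hv2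
      rw [hv, hv2, norm_mul, mul_pow]
      simp
    refine ⟨integrable_norm_sq_of_ae_eq _ h1, ?_⟩
    rw [integral_sq_eq_integral_norm_fourier_sq hs]
    exact integral_congr_ae h1
  · have hs := memLp_smooth hp hL (memLp_dilate hK hh)
    have hd : MemLp (fun x => smooth (dilate K h) p x - p x) 2 := hs.sub hp2
    have h0 : (hd.ofReal (K := ℂ)).toLp = (hs.ofReal (K := ℂ)).toLp - (hp2.ofReal (K := ℂ)).toLp := by
      rw [← MemLp.toLp_sub]
      congr 1
      ext x
      simp
    have h00 : (𝓕 ((hd.ofReal (K := ℂ)).toLp) : Lp ℂ 2 (volume : Measure (E d))) =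
        𝓕 ((hs.ofReal (K := ℂ)).toLp) - 𝓕 ((hp2.ofReal (K := ℂ)).toLp) := by
      rw [h0]
      exact map_sub (Lp.fourierTransformₗᵢ (E d) ℂ) _ _
    have h1 : (fun v => ‖(𝓕 ((hd.ofReal (K := ℂ)).toLp) :
        Lp ℂ 2 (volume : Measure (E d))) v‖ ^ 2) =ᵐ[volume]
        fun v => (1 - χ (h • v)) ^ 2 * ‖𝓕 (fun x => (p x : ℂ)) v‖ ^ 2 := by
      rw [h00]
      filter_upwards [fourier_smooth_ae_eq hp hL hK hh, hχ h hh, hpF,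
        Lp.coeFn_sub (𝓕 ((hs.ofReal (K := ℂ)).toLp) : Lp ℂ 2 (volume : Measure (E d)))
          (𝓕 ((hp2.ofReal (K := ℂ)).toLp))] with v hv hv2 hv3 hv4
      rw [hv4, Pi.sub_apply, hv, hv2, hv3]
      have h5 : (χ (h • v) : ℂ) * 𝓕 (fun x => (p x : ℂ)) v - 𝓕 (fun x => (p x : ℂ)) v =
          -((1 - χ (h • v) : ℝ) : ℂ) * 𝓕 (fun x => (p x : ℂ)) v := by
        push_cast
        ring
      refine (congrArg (fun z => ‖z‖ ^ 2) h5).trans ?_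
      rw [norm_mul, mul_pow, norm_neg, Complex.norm_real, Real.norm_eq_abs, sq_abs]
    refine ⟨integrable_norm_sq_of_ae_eq _ h1, ?_⟩
    rw [integral_sq_eq_integral_norm_fourier_sq hd]
    exact integral_congr_ae h1

/-- In the frequency domain the bias has multiplier `1 - χ(h v)`, which is nonnegative and grows
with `h`. -/
theorem integral_bias_sq_mono (hp : IsBoundedDensity L p) (hL : 0 ≤ L)
    (hK : MemLp K 2) (hF : HasMonotoneFourier K hK) {h h' : ℝ} (hh' : 0 < h') (hle : h' ≤ h) :
    ∫ x, (smooth (dilate K h') p x - p x) ^ 2 ≤ ∫ x, (smooth (dilate K h) p x - p x) ^ 2 := by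
  obtain ⟨χ, A, h01, hm, hA, hAi, -, -, hb⟩ := exists_spectral_representation hp hL hK hF
  rw [(hb h' hh').2, (hb h (hh'.trans_le hle)).2]
  refine integral_mono (hb h' hh').1 (hb h (hh'.trans_le hle)).1 fun v => ?_
  have := hm v h h' hh' hle
  exact mul_le_mul_of_nonneg_right
    (pow_le_pow_left₀ (by linarith [(h01 (h' • v)).2]) (by linarith) 2) (hA v)

theorem integral_smooth_sq_anti (hp : IsBoundedDensity L p) (hL : 0 ≤ L)
    (hK : MemLp K 2) (hF : HasMonotoneFourier K hK) {h h' : ℝ} (hh' : 0 < h') (hle : h' ≤ h) :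
    ∫ x, smooth (dilate K h) p x ^ 2 ≤ ∫ x, smooth (dilate K h') p x ^ 2 := by
  obtain ⟨χ, A, h01, hm, hA, hAi, -, hs, -⟩ := exists_spectral_representation hp hL hK hF
  rw [(hs h' hh').2, (hs h (hh'.trans_le hle)).2]
  refine integral_mono (hs h (hh'.trans_le hle)).1 (hs h' hh').1 fun v => ?_
  exact mul_le_mul_of_nonneg_right
    (pow_le_pow_left₀ (h01 _).1 (hm v h h' hh' hle) 2) (hA v)

theorem integral_smooth_sq_le_density (hp : IsBoundedDensity L p) (hL : 0 ≤ L)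
    (hK : MemLp K 2) (hF : HasMonotoneFourier K hK) {h : ℝ} (hh : 0 < h) :
    ∫ x, smooth (dilate K h) p x ^ 2 ≤ ∫ x, p x ^ 2 := by
  obtain ⟨χ, A, h01, hm, hA, hAi, hpA, hs, -⟩ := exists_spectral_representation hp hL hK hF
  rw [(hs h hh).2, hpA]
  refine integral_mono (hs h hh).1 hAi fun v => ?_
  exact mul_le_of_le_one_left (hA v) (pow_le_one₀ (h01 _).1 (h01 _).2)

/-- The squared bias is at most `‖p‖²`. -/
theorem integral_bias_sq_le_density (hp : IsBoundedDensity L p) (hL : 0 ≤ L)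
    (hK : MemLp K 2) (hF : HasMonotoneFourier K hK) {h : ℝ} (hh : 0 < h) :
    ∫ x, (smooth (dilate K h) p x - p x) ^ 2 ≤ ∫ x, p x ^ 2 := by
  obtain ⟨χ, A, h01, hm, hA, hAi, hpA, -, hb⟩ := exists_spectral_representation hp hL hK hF
  rw [(hb h hh).2, hpA]
  refine integral_mono (hb h hh).1 hAi fun v => ?_
  exact mul_le_of_le_one_left (hA v)
    (pow_le_one₀ (by linarith [(h01 (h • v)).2]) (by linarith [(h01 (h • v)).1]))

end

end

/-! ### Exact risk of a kernel estimator -/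

section

section

variable {Ω : Type*} {mΩ : MeasurableSpace Ω} (P : Measure Ω) [IsProbabilityMeasure P]
  {f : Ω → ℝ} (n : ℕ)

theorem memLp_pi_eval (hf : MemLp f 2 P) (i : Fin n) :
    MemLp (fun X : Fin n → Ω => f (X i)) 2 (Measure.pi fun _ => P) :=
  hf.comp_measurePreserving (measurePreserving_eval (fun _ : Fin n => P) i)

theorem memLp_empiricalMean (hf : MemLp f 2 P) :
    MemLp (fun X : Fin n → Ω => 1 / (n : ℝ) * ∑ i, f (X i)) 2 (Measure.pi fun _ => P) :=
  (memLp_finsetSum _ fun i _ => memLp_pi_eval P n hf i).const_mul _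

theorem integral_empiricalMean (hf : MemLp f 2 P) (hn : n ≠ 0) :
    ∫ X : Fin n → Ω, 1 / (n : ℝ) * ∑ i, f (X i) ∂(Measure.pi fun _ => P) = ∫ x, f x ∂P := by
  rw [integral_const_mul, integral_finsetSum _ fun i _ =>
    (memLp_pi_eval P n hf i).integrable (by norm_num)]
  have : ∀ i : Fin n, ∫ X : Fin n → Ω, f (X i) ∂(Measure.pi fun _ => P) = ∫ x, f x ∂P :=
    fun i => integral_comp_eval (μ := fun _ : Fin n => P) (i := i) hf.1
  simp_rw [this]
  have hn' : (n : ℝ) ≠ 0 := by exact_mod_cast hn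
  simp only [Finset.sum_const, Finset.card_univ, Fintype.card_fin, nsmul_eq_mul]
  field_simp

/-- Bias-variance decomposition of an empirical mean. -/
theorem integral_empiricalMean_sub_sq (hf : MemLp f 2 P) (hn : n ≠ 0) (c : ℝ) :
    ∫ X : Fin n → Ω, (1 / (n : ℝ) * ∑ i, f (X i) - c) ^ 2 ∂(Measure.pi fun _ => P) =
      (∫ x, f x ∂P - c) ^ 2 + 1 / (n : ℝ) * (∫ x, f x ^ 2 ∂P - (∫ x, f x ∂P) ^ 2) := by
  have hn' : (n : ℝ) ≠ 0 := by exact_mod_cast hn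
  set Z : (Fin n → Ω) → ℝ := fun X => 1 / (n : ℝ) * ∑ i, f (X i) with hZ
  have hZm : MemLp Z 2 (Measure.pi fun _ => P) := memLp_empiricalMean P n hf
  have hZ1 : Integrable Z (Measure.pi fun _ => P) := hZm.integrable (by norm_num)
  have hmean : ∫ X, Z X ∂(Measure.pi fun _ => P) = ∫ x, f x ∂P := integral_empiricalMean P n hf hn
  have hvar : ProbabilityTheory.variance Z (Measure.pi fun _ => P) =
      1 / (n : ℝ) * (∫ x, f x ^ 2 ∂P - (∫ x, f x ∂P) ^ 2) := by
    have h1 : ProbabilityTheory.variance (∑ i : Fin n, fun X : Fin n → Ω => f (X i))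
        (Measure.pi fun _ => P) = ∑ i : Fin n, ProbabilityTheory.variance
          (fun X : Fin n → Ω => f (X i)) (Measure.pi fun _ => P) := by
      apply ProbabilityTheory.IndepFun.variance_sum
      · exact fun i _ => memLp_pi_eval P n hf i
      · intro i _ j _ hij
        exact (ProbabilityTheory.iIndepFun_pi (μ := fun _ : Fin n => P) (X := fun _ => f)
          fun _ => hf.1.aemeasurable).indepFun hij
    have h2 : Z = fun X => 1 / (n : ℝ) * (∑ i : Fin n, fun X : Fin n → Ω => f (X i)) X := by
      ext X
      simp [hZ]
    have h3 : ∀ i : Fin n, ProbabilityTheory.variance (fun X : Fin n → Ω => f (X i))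
        (Measure.pi fun _ => P) = ∫ x, f x ^ 2 ∂P - (∫ x, f x ∂P) ^ 2 := by
      intro i
      rw [ProbabilityTheory.variance_eq_sub (memLp_pi_eval P n hf i)]
      have e1 : ∫ X : Fin n → Ω, f (X i) ∂(Measure.pi fun _ => P) = ∫ x, f x ∂P :=
        integral_comp_eval (μ := fun _ : Fin n => P) (i := i) hf.1
      have e2 : ∫ X : Fin n → Ω, f (X i) ^ 2 ∂(Measure.pi fun _ => P) = ∫ x, f x ^ 2 ∂P :=
        integral_comp_eval (μ := fun _ : Fin n => P) (i := i) (f := fun x => f x ^ 2) (hf.1.pow 2)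
      rw [e1]
      exact congrArg (· - _) e2
    rw [h2, ProbabilityTheory.variance_const_mul, h1]
    rw [Finset.sum_congr rfl fun i _ => h3 i]
    simp only [Finset.sum_const, Finset.card_univ, Fintype.card_fin, nsmul_eq_mul]
    field_simp
  rw [ProbabilityTheory.variance_eq_sub hZm, hmean] at hvar
  rw [← hvar]
  change ∫ X, (Z X - c) ^ 2 ∂_ = _
  have h4 : ∀ X, (Z X - c) ^ 2 = Z X ^ 2 - 2 * c * Z X + c ^ 2 := fun X => by ring
  simp_rw [h4]
  have hI : Integrable (fun X => Z X ^ 2 - 2 * c * Z X) (Measure.pi fun _ => P) :=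
    hZm.integrable_sq.sub (hZ1.const_mul _)
  rw [integral_add hI (integrable_const _),
    integral_sub hZm.integrable_sq (hZ1.const_mul _), integral_const_mul, hmean]
  simp
  ring

end

variable {d : ℕ} {L : ℝ} {p φ K : E d → ℝ}

theorem aemeasurable_sum_comp_sub (hp : IsBoundedDensity L p) (hφ : MemLp φ 2) (n : ℕ) :
    AEMeasurable (fun z : (Fin n → E d) × E d => 1 / (n : ℝ) * ∑ i, φ (z.1 i - z.2))
      ((sampleLaw p n).prod volume) := by
  have := hp.isProbabilityMeasure
  rw [sampleLaw_eq]
  refine (Finset.aemeasurable_fun_sum _ fun i _ => ?_).const_mul _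
  have h1 : MeasurePreserving (Prod.map (Function.eval i) id : (Fin n → E d) × E d → E d × E d)
      ((Measure.pi fun _ => law p).prod (volume : Measure (E d)))
      ((law p).prod (volume : Measure (E d))) :=
    (measurePreserving_eval (fun _ : Fin n => law p) i).prod (MeasurePreserving.id (volume : Measure (E d)))
  have h2 : MeasurePreserving Prod.swap ((law p).prod (volume : Measure (E d)))
      ((volume : Measure (E d)).prod (law p)) :=
    Measure.measurePreserving_swap
  exact ((aestronglyMeasurable_comp_sub hp hφ).comp_measurePreserving (h2.comp h1)).aemeasurable

/-- After Tonelli, each point `x` carries the bias-variance decomposition of the empirical mean of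
`φ(X - x)`. The second moments integrate to `‖φ‖²`, whatever `p` is. -/
theorem risk_mean_comp_sub (hp : IsBoundedDensity L p) (hL : 0 ≤ L) (hφ : MemLp φ 2) {n : ℕ}
    (hn : n ≠ 0) :
    risk p (fun (X : Fin n → E d) x => 1 / (n : ℝ) * ∑ i, φ (X i - x)) =
      ENNReal.ofReal ((∫ x, (smooth φ p x - p x) ^ 2) +
        1 / (n : ℝ) * ((∫ x, φ x ^ 2) - ∫ x, smooth φ p x ^ 2)) := by
  have := hp.isProbabilityMeasure
  have hs := memLp_smooth hp hL hφ
  have hb : MemLp (fun x => smooth φ p x - p x) 2 := hs.sub (hp.memLp_two hL)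
  have hmeas : AEMeasurable (Function.uncurry fun (X : Fin n → E d) (x : E d) =>
      ENNReal.ofReal ((1 / (n : ℝ) * ∑ i, φ (X i - x) - p x) ^ 2))
      ((sampleLaw p n).prod volume) := by
    refine AEMeasurable.ennreal_ofReal (AEMeasurable.pow_const ?_ 2)
    refine (aemeasurable_sum_comp_sub hp hφ n).sub ?_
    have h1 : AEMeasurable p volume := hp.integrable.aestronglyMeasurable.aemeasurable
    exact h1.comp_quasiMeasurePreserving Measure.quasiMeasurePreserving_snd
  have hsf : SFinite (sampleLaw p n) := by rw [sampleLaw_eq]; infer_instance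
  rw [risk, lintegral_lintegral_swap hmeas]
  have hinner : ∀ x, ∫⁻ X : Fin n → E d,
      ENNReal.ofReal ((1 / (n : ℝ) * ∑ i, φ (X i - x) - p x) ^ 2) ∂(sampleLaw p n) =
      ENNReal.ofReal ((smooth φ p x - p x) ^ 2 +
        1 / (n : ℝ) * (∫ y, φ (y - x) ^ 2 ∂(law p) - smooth φ p x ^ 2)) := by
    intro x
    have hm := hp.memLp_law hL (memLp_comp_sub hφ x)
    rw [sampleLaw_eq, ← ofReal_integral_eq_lintegral_ofReal]
    · rw [integral_empiricalMean_sub_sq (law p) n hm hn]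
      rfl
    · exact ((memLp_empiricalMean (law p) n hm).sub (memLp_const (p x))).integrable_sq
    · exact Filter.Eventually.of_forall fun X => sq_nonneg _
  simp_rw [hinner]
  have hV := integrable_integral_comp_sub_sq hp hφ
  rw [← ofReal_integral_eq_lintegral_ofReal]
  · have hI : Integrable (fun x => 1 / (n : ℝ) * (∫ y, φ (y - x) ^ 2 ∂(law p) - smooth φ p x ^ 2)) :=
      (hV.sub hs.integrable_sq).const_mul _
    rw [integral_add hb.integrable_sq hI, integral_const_mul]
    congr 3
    rw [← integral_integral_comp_sub_sq hp hφ]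
    exact integral_sub hV hs.integrable_sq
  · exact hb.integrable_sq.add ((hV.sub hs.integrable_sq).const_mul _)
  · refine Filter.Eventually.of_forall fun x => ?_
    have := smooth_sq_le hp hL hφ x
    have h2 : 0 ≤ 1 / (n : ℝ) * (∫ y, φ (y - x) ^ 2 ∂(law p) - smooth φ p x ^ 2) :=
      mul_nonneg (by positivity) (by linarith)
    simp only [Pi.zero_apply]
    positivity

/-- Exact mean integrated squared error of a kernel estimator. -/
theorem risk_kernelEstimator (hp : IsBoundedDensity L p) (hL : 0 ≤ L) (hK : MemLp K 2) {n : ℕ}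
    (hn : n ≠ 0) {h : ℝ} (hh : 0 < h) :
    risk p (fun X : Fin n → E d => kernelEstimator K h X) =
      ENNReal.ofReal ((∫ x, (smooth (dilate K h) p x - p x) ^ 2) +
        1 / (n : ℝ) * (l2Norm K ^ 2 / h ^ d - ∫ x, smooth (dilate K h) p x ^ 2)) := by
  rw [← integral_dilate_sq K hh, ← risk_mean_comp_sub hp hL (memLp_dilate hK hh) hn]
  congr 1
  ext X x
  exact kernelEstimator_eq K h X x

end

/-! ### Projection inequalities in a Hilbert space -/

section

section Hilbert

variable {H : Type*} [NormedAddCommGroup H] [InnerProductSpace ℝ H]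

/-- If `t` is a projection of `g₀` in the sense of the variational inequality at `q`, then it is
nearly as close to `P` as `q` is. -/
theorem norm_sub_sq_le_of_inner_nonpos {t q g₀ P P' : H}
    (h1 : inner ℝ (g₀ - t) (q - t) ≤ 0) (h2 : inner ℝ (P - P') (q - t) = 0) :
    ‖t - P‖ ^ 2 ≤ ‖q - P‖ ^ 2 + ‖g₀ - P'‖ ^ 2 := by
  have e1 : q - P = (q - t) - (P - t) := by abel
  have e2 : inner ℝ (P - t) (q - t) =
      inner ℝ (P' - g₀) (q - t) + inner ℝ (P - P') (q - t) + inner ℝ (g₀ - t) (q - t) := by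
    rw [← inner_add_left, ← inner_add_left]
    congr 1
    abel
  have e3 := norm_sub_sq_real (q - t) (P - t)
  have e4 := norm_sub_sq_real (P' - g₀) (q - t)
  have e5 : inner ℝ (q - t) (P - t) = inner ℝ (P - t) (q - t) := real_inner_comm _ _
  rw [e1, norm_sub_rev t P, norm_sub_rev g₀ P']
  -- The cross term `2⟨P' - g₀, q - t⟩` is at most `‖P' - g₀‖² + ‖q - t‖²`, and `‖q - t‖²` cancels
  -- against the same term in the expansion of `‖q - P‖²`.
  nlinarith [sq_nonneg ‖(P' - g₀) - (q - t)‖]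

/-- First order condition along a segment. -/
theorem le_inner_of_forall_segment {t u : H} {a : ℝ}
    (h : ∀ s : ℝ, 0 < s → s ≤ 1 → ‖t‖ ^ 2 ≤ ‖t + s • u‖ ^ 2 - 2 * s * a) : a ≤ inner ℝ t u := by
  by_contra hlt
  push Not at hlt
  set δ := a - inner ℝ t u with hδ
  have hδ0 : 0 < δ := by linarith
  -- For such a step the quadratic term `s ^ 2 * ‖u‖ ^ 2` is below the linear gain `2 * s * δ`.
  set s := min 1 (δ / (‖u‖ ^ 2 + 1)) with hs
  have hs0 : 0 < s := lt_min one_pos (by positivity)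
  have h1 := h s hs0 (min_le_left _ _)
  rw [norm_add_sq_real, inner_smul_right, norm_smul, mul_pow, Real.norm_eq_abs, sq_abs] at h1
  have h2 : s * (‖u‖ ^ 2 + 1) ≤ δ := by
    rw [← le_div_iff₀ (by positivity)]
    exact min_le_right _ _
  have h3 : 0 ≤ s * (s * ‖u‖ ^ 2 - 2 * δ) := by
    rw [hδ]
    linarith
  have h4 := nonneg_of_mul_nonneg_right h3 hs0
  nlinarith

end Hilbert

variable {d : ℕ}

theorem norm_toLp_sq {f : E d → ℝ} (hf : MemLp f 2) : ‖hf.toLp‖ ^ 2 = ∫ x, f x ^ 2 := by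
  rw [← real_inner_self_eq_norm_sq, L2.inner_def]
  apply integral_congr_ae
  filter_upwards [hf.coeFn_toLp] with x hx
  rw [hx]
  simp [sq]

theorem inner_toLp {f g : E d → ℝ} (hf : MemLp f 2) (hg : MemLp g 2) :
    inner ℝ hf.toLp hg.toLp = ∫ x, f x * g x := by
  rw [L2.inner_def]
  apply integral_congr_ae
  filter_upwards [hf.coeFn_toLp, hg.coeFn_toLp] with x hx hx'
  rw [hx, hx']
  simp [mul_comm]

section

variable {M l : ℕ} {q : Fin M → E d → ℝ}

theorem memLp_linearCombination (hq : ∀ j, MemLp (q j) 2) (c : Fin M → ℝ) :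
    MemLp (fun x => ∑ j, c j * q j x) 2 :=
  memLp_finsetSum _ fun j _ => (hq j).const_mul (c j)

theorem toLp_linearCombination (hq : ∀ j, MemLp (q j) 2) (c : Fin M → ℝ) :
    (memLp_linearCombination hq c).toLp = ∑ j, c j • (hq j).toLp := by
  have key : ∀ s : Finset (Fin M),
      (memLp_finsetSum s fun j _ => (hq j).const_mul (c j)).toLp (fun x => ∑ j ∈ s, c j * q j x) =
        ∑ j ∈ s, c j • (hq j).toLp := by
    intro s
    induction s using Finset.induction_on with
    | empty =>
      simp only [Finset.sum_empty]
      exact MemLp.toLp_zero _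
    | insert a s ha ih =>
      simp only [Finset.sum_insert ha]
      rw [← ih]
      rfl
  exact key Finset.univ

end

end

/-! ### First order conditions for the aggregates -/

section

variable {d M l : ℕ} {q : Fin M → E d → ℝ}

/-- The empirical mean of `f` over the sample `Y`. -/
noncomputable def empMean (f : E d → ℝ) (Y : Fin l → E d) : ℝ := 1 / (l : ℝ) * ∑ i, f (Y i)

theorem empMean_linearCombination (q : Fin M → E d → ℝ) (c : Fin M → ℝ) (Y : Fin l → E d) :
    empMean (fun x => ∑ j, c j * q j x) Y = ∑ j, c j * empMean (q j) Y := by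
  simp only [empMean, Finset.mul_sum]
  rw [Finset.sum_comm]
  refine Finset.sum_congr rfl fun j _ => Finset.sum_congr rfl fun i _ => ?_
  ring

theorem criterion_eq (hq : ∀ j, MemLp (q j) 2) (Y : Fin l → E d) (w : Fin M → ℝ) :
    criterion q Y w = ‖∑ j, w j • (hq j).toLp‖ ^ 2 - 2 * ∑ j, w j * empMean (q j) Y := by
  rw [criterion, ← toLp_linearCombination hq w, norm_toLp_sq, ← empMean_linearCombination, empMean]
  ring

/-- Both kinds of aggregates are combinations of `q₁, …, q_M` that satisfy the first order condition
of the empirical criterion towards each `q_j`. -/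
def IsFirstOrder (hq : ∀ j, MemLp (q j) 2) (Y : Fin l → E d) (g : E d → ℝ) : Prop :=
  ∃ c : Fin M → ℝ, (g = fun x => ∑ j, c j * q j x) ∧
    ∀ j, empMean (q j) Y - ∑ i, c i * empMean (q i) Y ≤
      inner ℝ (∑ i, c i • (hq i).toLp) ((hq j).toLp - ∑ i, c i • (hq i).toLp)

/-- The segment from the minimizer to the `j`-th vertex stays in the convex set of weights, so the
criterion has nonnegative slope along it. -/
theorem IsConvexAggregate.isFirstOrder (hq : ∀ j, MemLp (q j) 2) {Y : Fin l → E d}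
    {g : E d → ℝ} (hg : IsConvexAggregate q Y g) : IsFirstOrder hq Y g := by
  obtain ⟨w, ⟨hw0, hw1⟩, hmin, hgw⟩ := hg
  refine ⟨w, hgw, fun j => le_inner_of_forall_segment fun s hs0 hs1 => ?_⟩
  set v : Fin M → ℝ := fun i => w i + s * ((if i = j then 1 else 0) - w i) with hv
  have hvmem : v ∈ weights M := by
    constructor
    · intro i
      have h1 : v i = (1 - s) * w i + s * (if i = j then 1 else 0) := by
        simp only [hv]
        ring
      rw [h1]
      have := hw0 i
      have h2 : (0 : ℝ) ≤ if i = j then 1 else 0 := by split_ifs <;> norm_num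
      have h3 : 0 ≤ 1 - s := by linarith
      positivity
    · have h1 : ∑ i, v i = ∑ i, w i + s * (1 - ∑ i, w i) := by
        simp [hv, Finset.sum_add_distrib, ← Finset.mul_sum, Finset.sum_sub_distrib]
      rw [h1]
      nlinarith
  have h := hmin v hvmem
  rw [criterion_eq hq, criterion_eq hq] at h
  have e1 : ∑ i, v i • (hq i).toLp =
      ∑ i, w i • (hq i).toLp + s • ((hq j).toLp - ∑ i, w i • (hq i).toLp) := by
    simp [hv, add_smul, mul_smul, sub_smul, Finset.sum_add_distrib, ← Finset.smul_sum,
      Finset.sum_sub_distrib]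
  have e2 : ∑ i, v i * empMean (q i) Y = ∑ i, w i * empMean (q i) Y +
      s * (empMean (q j) Y - ∑ i, w i * empMean (q i) Y) := by
    simp [hv, add_mul, mul_assoc, sub_mul, Finset.sum_add_distrib, ← Finset.mul_sum,
      Finset.sum_sub_distrib]
  rw [e1, e2] at h
  linarith

/-- Empirical means see point values, whereas the span is one of `L₂` classes. The hypothesis `hY`
makes the empirical mean well defined on classes; it holds for almost every sample. -/
theorem IsLinearAggregate.isFirstOrder (hq : ∀ j, MemLp (q j) 2) {Y : Fin l → E d}
    {g : E d → ℝ} (hg : IsLinearAggregate q Y g)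
    (hY : ∀ c : Fin M → ℝ,
      ∑ i, c i • (hq i).toLp (q i) = (0 : Lp ℝ 2 (volume : Measure (E d))) →
      ∑ i, c i * empMean (q i) Y = 0) :
    IsFirstOrder hq Y g := by
  obtain ⟨M', φ, hspan, horth, hrep, hgφ⟩ := hg
  have h1 : ∀ k, ∃ A : Fin M → ℝ, φ k = fun x => ∑ j, A j * q j x := by
    intro k
    obtain ⟨A, hA⟩ := (Submodule.mem_span_range_iff_exists_fun ℝ).1 (hspan k)
    refine ⟨A, ?_⟩
    rw [← hA]
    ext x
    simp
  choose A hA using h1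
  have hφ : ∀ k, MemLp (φ k) 2 := fun k => by
    rw [hA k]
    exact memLp_linearCombination hq (A k)
  have hTφ : ∀ k, (hφ k).toLp = ∑ i, A k i • (hq i).toLp := by
    intro k
    rw [← toLp_linearCombination hq (A k)]
    exact (MemLp.toLp_eq_toLp_iff _ _).2 (by rw [hA k])
  have hNφ : ∀ k, empMean (φ k) Y = ∑ i, A k i * empMean (q i) Y := by
    intro k
    rw [hA k, empMean_linearCombination]
  set e : Fin M' → ℝ := fun k => empMean (φ k) Y with he
  set c : Fin M → ℝ := fun i => ∑ k, e k * A k i with hc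
  have hsumE : ∀ a : Fin M' → ℝ, ∑ i, (∑ k, a k * A k i) • (hq i).toLp =
      ∑ k, a k • (hφ k).toLp := by
    intro a
    simp_rw [hTφ, Finset.smul_sum, Finset.sum_smul, smul_smul]
    exact Finset.sum_comm
  have hsumN : ∀ a : Fin M' → ℝ, ∑ i, (∑ k, a k * A k i) * empMean (q i) Y =
      ∑ k, a k * e k := by
    intro a
    simp_rw [he, hNφ, Finset.mul_sum, Finset.sum_mul, mul_assoc]
    exact Finset.sum_comm
  have horth' : ∀ k k', inner ℝ (hφ k).toLp (hφ k').toLp = if k = k' then (1 : ℝ) else 0 := by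
    intro k k'
    rw [inner_toLp, horth]
  refine ⟨c, ?_, fun j => ?_⟩
  · rw [hgφ]
    ext x
    simp only [hc, Finset.sum_mul]
    rw [Finset.sum_comm]
    refine Finset.sum_congr rfl fun k _ => ?_
    have h2 : φ k x = ∑ j, A k j * q j x := congrFun (hA k) x
    rw [h2, Finset.mul_sum]
    refine Finset.sum_congr rfl fun i _ => ?_
    simp only [he, empMean]
    ring
  · obtain ⟨ν, hν⟩ := hrep j
    have hQ : (hq j).toLp = ∑ k, ν k • (hφ k).toLp := by
      rw [← toLp_linearCombination hφ ν]
      exact (MemLp.toLp_eq_toLp_iff _ _).2 hν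
    have hN : empMean (q j) Y = ∑ k, ν k * e k := by
      -- These coefficients represent `∑ k, ν k • φ k - q j`, which vanishes almost everywhere.
      have h3 := hY (fun i => (∑ k, ν k * A k i) - if i = j then 1 else 0) (by
        simp only [sub_smul, Finset.sum_sub_distrib]
        rw [hsumE, ← hQ]
        simp)
      simp only [sub_mul, Finset.sum_sub_distrib] at h3
      rw [hsumN] at h3
      simp at h3
      linarith
    have hi : ∀ a b : Fin M' → ℝ, inner ℝ (∑ k, a k • (hφ k).toLp) (∑ k, b k • (hφ k).toLp) =
        ∑ k, a k * b k := by
      intro a b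
      simp [sum_inner, inner_sum, inner_smul_left, inner_smul_right, horth', mul_comm]
    -- On the full span the condition is an equality: the aggregate represents the empirical mean
    -- there.
    apply le_of_eq
    simp only [hc]
    rw [hsumE, hsumN, hN, hQ, inner_sub_right, hi, hi]
    congr 1
    exact Finset.sum_congr rfl fun k _ => mul_comm _ _

/-- Deterministic comparison of an aggregate with each of `q₁, …, q_M`, in terms of a Riesz
representer `g₀` of the empirical mean. -/
theorem IsFirstOrder.integral_sub_sq_le {hq : ∀ j, MemLp (q j) 2} {Y : Fin l → E d}
    {g p : E d → ℝ} (hg : IsFirstOrder hq Y g) (hp : MemLp p 2 volume)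
    {g₀ P' : Lp ℝ 2 (volume : Measure (E d))}
    (hg₀ : ∀ j, empMean (q j) Y = inner ℝ g₀ ((hq j).toLp (q j)))
    (hP : ∀ j, inner ℝ (hp.toLp p - P') ((hq j).toLp (q j)) = 0) (j : Fin M) :
    ∫ x, (g x - p x) ^ 2 ≤ (∫ x, (q j x - p x) ^ 2) + ‖g₀ - P'‖ ^ 2 := by
  obtain ⟨c, rfl, hc⟩ := hg
  have h1 : inner ℝ (g₀ - ∑ i, c i • (hq i).toLp) ((hq j).toLp - ∑ i, c i • (hq i).toLp) ≤ 0 := by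
    have h2 : inner ℝ g₀ ((hq j).toLp - ∑ i, c i • (hq i).toLp) =
        empMean (q j) Y - ∑ i, c i * empMean (q i) Y := by
      simp [inner_sub_right, inner_sum, inner_smul_right, hg₀]
    rw [inner_sub_left, h2]
    linarith [hc j]
  have h3 : inner ℝ (hp.toLp - P') ((hq j).toLp - ∑ i, c i • (hq i).toLp) = 0 := by
    rw [inner_sub_right, inner_sum]
    simp [inner_smul_right, hP]
  have h4 := norm_sub_sq_le_of_inner_nonpos h1 h3
  rw [← toLp_linearCombination hq c, ← MemLp.toLp_sub, ← MemLp.toLp_sub, norm_toLp_sq,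
    norm_toLp_sq] at h4
  exact h4

theorem exists_orthonormal_of_finite {H : Type*} [NormedAddCommGroup H] [InnerProductSpace ℝ H]
    (Q : Fin M → H) : ∃ M' ≤ M, ∃ b : Fin M' → H, Orthonormal ℝ b ∧
      ∀ j, Q j = ∑ k, inner ℝ (b k) (Q j) • b k := by
  let W := Submodule.span ℝ (Set.range Q)
  have : FiniteDimensional ℝ W := FiniteDimensional.span_of_finite ℝ (Set.finite_range Q)
  let b := stdOrthonormalBasis ℝ W
  refine ⟨Module.finrank ℝ W, ?_, fun k => (b k : H), ?_, fun j => ?_⟩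
  · have := finrank_range_le_card (R := ℝ) Q
    rwa [Fintype.card_fin] at this
  · exact b.orthonormal.comp_linearIsometry W.subtypeₗᵢ
  · have h := b.sum_repr' ⟨Q j, Submodule.subset_span ⟨j, rfl⟩⟩
    have h2 := congrArg (fun z : W => (z : H)) h
    simp only [Submodule.coe_sum, Submodule.coe_smul, Submodule.coe_inner] at h2
    exact h2.symm

end

/-! ### Oracle inequality with fixed initial estimators -/

section

variable {d M l : ℕ} {L : ℝ} {p : E d → ℝ} {q : Fin M → E d → ℝ}

theorem Orthonormal.norm_sum_smul_sub_sq {H : Type*} [NormedAddCommGroup H] [InnerProductSpace ℝ H]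
    {n : ℕ} {b : Fin n → H} (hb : Orthonormal ℝ b) (a c : Fin n → ℝ) :
    ‖∑ k, a k • b k - ∑ k, c k • b k‖ ^ 2 = ∑ k, (a k - c k) ^ 2 := by
  rw [← Finset.sum_sub_distrib]
  simp_rw [← sub_smul]
  rw [← real_inner_self_eq_norm_sq, hb.inner_sum]
  exact Finset.sum_congr rfl fun k _ => by simp [sq]

theorem ae_sampleLaw_forall (hp : IsBoundedDensity L p) (l : ℕ) {s : E d → Prop}
    (hs : ∀ᵐ x, s x) : ∀ᵐ Y ∂(sampleLaw p l), ∀ i, s (Y i) := by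
  have := hp.isProbabilityMeasure
  rw [sampleLaw_eq]
  refine ae_all_iff.2 fun i => ?_
  exact (measurePreserving_eval (fun _ : Fin l => law p) i).quasiMeasurePreserving.ae
    ((IsBoundedDensity.law_absolutelyContinuous p).ae_le hs)

theorem lintegral_ofReal_sub_sq {f g : E d → ℝ} (hf : MemLp f 2) (hg : MemLp g 2) :
    ∫⁻ x, ENNReal.ofReal ((f x - g x) ^ 2) = ENNReal.ofReal (∫ x, (f x - g x) ^ 2) :=
  (ofReal_integral_eq_lintegral_ofReal (hf.sub hg).integrable_sq
    (Filter.Eventually.of_forall fun _ => sq_nonneg _)).symm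

/-- Oracle inequality for both kinds of aggregates, for fixed initial estimators. -/
theorem lintegral_aggregate_le (hp : IsBoundedDensity L p) (hL : 0 ≤ L)
    (hq : ∀ j, MemLp (q j) 2) (hl : l ≠ 0) {g : (Fin l → E d) → E d → ℝ}
    (hg : (∀ Y, IsLinearAggregate q Y (g Y)) ∨ (∀ Y, IsConvexAggregate q Y (g Y))) (j : Fin M) :
    ∫⁻ Y, ∫⁻ x, ENNReal.ofReal ((g Y x - p x) ^ 2) ∂volume ∂(sampleLaw p l) ≤
      (∫⁻ x, ENNReal.ofReal ((q j x - p x) ^ 2)) + ENNReal.ofReal (L * M / l) := by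
  have hprob := hp.isProbabilityMeasure
  have hprob' : IsProbabilityMeasure (sampleLaw p l) := by
    rw [sampleLaw_eq]
    infer_instance
  have hp2 := hp.memLp_two hL
  -- This basis does not depend on the validation sample, unlike the bases hidden in the linear
  -- aggregates, so its empirical coefficients have plain variances.
  obtain ⟨M', hM', b, hb, hrep⟩ := exists_orthonormal_of_finite fun j => (hq j).toLp (q j)
  set ν : Fin M → Fin M' → ℝ := fun j k => inner ℝ (b k) ((hq j).toLp (q j)) with hν
  have hbm : ∀ k, MemLp (b k) 2 := fun k => Lp.memLp (b k)
  have hbq : ∀ j, q j =ᵐ[volume] fun x => ∑ k, ν j k * b k x := by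
    intro j
    refine (MemLp.toLp_eq_toLp_iff (hq j) (memLp_linearCombination hbm (ν j))).1 ?_
    rw [toLp_linearCombination hbm (ν j)]
    simp only [Lp.toLp_coeFn]
    exact hrep j
  set G₀ : (Fin l → E d) → Lp ℝ 2 (volume : Measure (E d)) :=
    fun Y => ∑ k, empMean (b k) Y • b k with hG₀
  set P' : Lp ℝ 2 (volume : Measure (E d)) := ∑ k, inner ℝ (b k) (hp2.toLp p) • b k with hP'
  have hQ : ∀ (a : Fin M' → ℝ) j, inner ℝ (∑ k, a k • b k) ((hq j).toLp (q j)) =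
      ∑ k, a k * ν j k := by
    intro a j
    simp [sum_inner, inner_smul_left, hν]
  have hPQ : ∀ j, inner ℝ (hp2.toLp p - P') ((hq j).toLp (q j)) = 0 := by
    intro j
    rw [inner_sub_left, hP', hQ]
    nth_rw 1 [hrep j]
    rw [inner_sum, sub_eq_zero]
    refine Finset.sum_congr rfl fun k _ => ?_
    rw [inner_smul_right, real_inner_comm (b k), mul_comm]
  have hgood : ∀ᵐ Y ∂(sampleLaw p l), ∀ j, empMean (q j) Y = inner ℝ (G₀ Y) ((hq j).toLp (q j)) := by
    filter_upwards [ae_sampleLaw_forall hp l (ae_all_iff.2 hbq)] with Y hY j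
    rw [hG₀, hQ]
    have : empMean (q j) Y = empMean (fun x => ∑ k, ν j k * b k x) Y := by
      simp only [empMean]
      congr 1
      exact Finset.sum_congr rfl fun i _ => hY i j
    rw [this, empMean_linearCombination (fun k => (b k : E d → ℝ))]
    exact Finset.sum_congr rfl fun k _ => mul_comm _ _
  set a : ℝ := ∫ x, (q j x - p x) ^ 2 with ha
  set S : (Fin l → E d) → ℝ := fun Y => ∑ k, (empMean (b k) Y - ∫ x, b k x ∂(law p)) ^ 2 with hS
  have hbP : ∀ k, inner ℝ (b k) (hp2.toLp p) = ∫ x, b k x ∂(law p) := by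
    intro k
    rw [hp.integral_law]
    have h1 := inner_toLp (hbm k) hp2
    rw [Lp.toLp_coeFn] at h1
    rw [h1]
    exact integral_congr_ae (Filter.Eventually.of_forall fun x => mul_comm _ _)
  have hbound : ∀ᵐ Y ∂(sampleLaw p l), ∫⁻ x, ENNReal.ofReal ((g Y x - p x) ^ 2) ≤
      ENNReal.ofReal (a + S Y) := by
    filter_upwards [hgood] with Y hY
    have hfo : IsFirstOrder hq Y (g Y) := by
      rcases hg with hg | hg
      · refine (hg Y).isFirstOrder hq fun c hc => ?_
        have h1 : inner ℝ (G₀ Y) (∑ i, c i • (hq i).toLp (q i)) = 0 := by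
          rw [hc, inner_zero_right]
        rw [inner_sum] at h1
        simpa [inner_smul_right, ← hY] using h1
      · exact (hg Y).isFirstOrder hq
    have h1 := hfo.integral_sub_sq_le hp2 hY hPQ j
    have h2 : ‖G₀ Y - P'‖ ^ 2 = S Y := by
      rw [hG₀, hP', Orthonormal.norm_sum_smul_sub_sq hb]
      simp_rw [hbP]
      rfl
    have hgm : MemLp (g Y) 2 := by
      obtain ⟨c, hc, -⟩ := hfo
      rw [hc]
      exact memLp_linearCombination hq c
    rw [h2] at h1
    rw [lintegral_ofReal_sub_sq hgm hp2]
    exact ENNReal.ofReal_le_ofReal h1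
  have hterm : ∀ k, MemLp (fun Y : Fin l → E d => empMean (b k) Y - ∫ x, b k x ∂(law p)) 2
      (sampleLaw p l) := fun k =>
    (memLp_empiricalMean (law p) l (hp.memLp_law hL (hbm k))).sub (memLp_const _)
  have hSi : Integrable S (sampleLaw p l) := integrable_finsetSum _ fun k _ => (hterm k).integrable_sq
  have hSle : ∫ Y, S Y ∂(sampleLaw p l) ≤ L * M / l := by
    rw [integral_finsetSum _ fun k _ => (hterm k).integrable_sq]
    have h1 : ∀ k ∈ Finset.univ, ∫ Y : Fin l → E d, (empMean (b k) Y - ∫ x, b k x ∂(law p)) ^ 2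
        ∂(sampleLaw p l) ≤ L / l := by
      intro k _
      have h2 := integral_empiricalMean_sub_sq (law p) l (hp.memLp_law hL (hbm k)) hl
        (∫ x, b k x ∂(law p))
      have h3 := hp.integral_sq_law_le hL (hbm k)
      have h4 : ∫ x, b k x ^ 2 = 1 := by
        rw [← norm_toLp_sq (hbm k), Lp.toLp_coeFn, hb.1 k, one_pow]
      rw [h4] at h3
      refine h2.le.trans ?_
      rw [sub_self, one_div, div_eq_mul_inv, mul_comm L]
      have h5 : (0 : ℝ) ≤ (l : ℝ)⁻¹ := by positivity
      nlinarith [mul_nonneg h5 (sq_nonneg (∫ x, b k x ∂(law p))), mul_le_mul_of_nonneg_left h3 h5]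
    refine (Finset.sum_le_sum h1).trans ?_
    rw [Finset.sum_const, Finset.card_univ, Fintype.card_fin, nsmul_eq_mul]
    have h6 : (M' : ℝ) ≤ M := by exact_mod_cast hM'
    calc (M' : ℝ) * (L / l) ≤ M * (L / l) := mul_le_mul_of_nonneg_right h6 (by positivity)
      _ = L * M / l := by ring
  have ha0 : 0 ≤ a := integral_nonneg fun x => sq_nonneg _
  have hS0 : ∀ Y, 0 ≤ S Y := fun Y => Finset.sum_nonneg fun k _ => sq_nonneg _
  calc ∫⁻ Y, ∫⁻ x, ENNReal.ofReal ((g Y x - p x) ^ 2) ∂volume ∂(sampleLaw p l)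
      ≤ ∫⁻ Y, ENNReal.ofReal (a + S Y) ∂(sampleLaw p l) := lintegral_mono_ae hbound
    _ = ENNReal.ofReal (∫ Y, (a + S Y) ∂(sampleLaw p l)) := by
        have hI : Integrable (fun Y => a + S Y) (sampleLaw p l) := (integrable_const a).add hSi
        rw [ofReal_integral_eq_lintegral_ofReal hI
          (Filter.Eventually.of_forall fun Y => add_nonneg ha0 (hS0 Y))]
    _ ≤ ENNReal.ofReal (a + L * M / l) := by
        apply ENNReal.ofReal_le_ofReal
        rw [integral_add (integrable_const a) hSi]
        simpa using hSle
    _ = _ := by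
        rw [ENNReal.ofReal_add ha0 (by positivity), ha, lintegral_ofReal_sub_sq (hq j) hp2]

end

/-! ### Averaging over splits and independence of the two samples -/

section

variable {d n : ℕ} {L a₀ : ℝ} {p K : E d → ℝ}

theorem risk_eq_lintegral_prod (hp : IsBoundedDensity L p) {est : (Fin n → E d) → E d → ℝ}
    (hest : AEMeasurable (Function.uncurry est) ((sampleLaw p n).prod volume)) :
    AEMeasurable (fun z : (Fin n → E d) × E d => ENNReal.ofReal ((est z.1 z.2 - p z.2) ^ 2))
      ((sampleLaw p n).prod volume) ∧
    risk p est = ∫⁻ z, ENNReal.ofReal ((est z.1 z.2 - p z.2) ^ 2) ∂((sampleLaw p n).prod volume) := by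
  have hm : AEMeasurable (fun z : (Fin n → E d) × E d =>
      ENNReal.ofReal ((est z.1 z.2 - p z.2) ^ 2)) ((sampleLaw p n).prod volume) := by
    refine AEMeasurable.ennreal_ofReal (AEMeasurable.pow_const ?_ 2)
    have h1 : AEMeasurable p volume := hp.integrable.aestronglyMeasurable.aemeasurable
    exact AEMeasurable.sub hest (h1.comp_quasiMeasurePreserving Measure.quasiMeasurePreserving_snd)
  exact ⟨hm, (lintegral_prod _ hm).symm⟩

/-- The squared loss is convex, so averaging over splits does not increase the risk. -/
theorem risk_averaged_le (hp : IsBoundedDensity L p) {S : Finset (Split n)} (hS : S.Nonempty)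
    {g : Split n → (Fin n → E d) → E d → ℝ}
    (hg : ∀ σ ∈ S, AEMeasurable (Function.uncurry (g σ)) ((sampleLaw p n).prod volume))
    {B : ℝ≥0∞} (hB : ∀ σ ∈ S, risk p (g σ) ≤ B) : risk p (averaged S g) ≤ B := by
  have hcard : (0 : ℝ) < S.card := by exact_mod_cast hS.card_pos
  have hpt : ∀ z : (Fin n → E d) × E d,
      ENNReal.ofReal ((averaged S g z.1 z.2 - p z.2) ^ 2) ≤
        ENNReal.ofReal (1 / (S.card : ℝ)) *
          ∑ σ ∈ S, ENNReal.ofReal ((g σ z.1 z.2 - p z.2) ^ 2) := by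
    intro z
    rw [← ENNReal.ofReal_sum_of_nonneg fun σ _ => sq_nonneg _,
      ← ENNReal.ofReal_mul (by positivity)]
    apply ENNReal.ofReal_le_ofReal
    have h1 := sq_sum_le_card_mul_sum_sq (s := S) (f := fun σ => g σ z.1 z.2 - p z.2)
    have h2 : averaged S g z.1 z.2 - p z.2 = 1 / (S.card : ℝ) * ∑ σ ∈ S, (g σ z.1 z.2 - p z.2) := by
      simp only [averaged, Finset.sum_sub_distrib, Finset.sum_const, nsmul_eq_mul]
      field_simp
    rw [h2, mul_pow]
    calc (1 / (S.card : ℝ)) ^ 2 * (∑ σ ∈ S, (g σ z.1 z.2 - p z.2)) ^ 2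
        ≤ (1 / (S.card : ℝ)) ^ 2 * (S.card * ∑ σ ∈ S, (g σ z.1 z.2 - p z.2) ^ 2) :=
          mul_le_mul_of_nonneg_left h1 (by positivity)
      _ = _ := by field_simp
  have hprob := hp.isProbabilityMeasure
  calc risk p (averaged S g)
      ≤ ∫⁻ X, ∫⁻ x, ENNReal.ofReal (1 / (S.card : ℝ)) *
          ∑ σ ∈ S, ENNReal.ofReal ((g σ X x - p x) ^ 2) ∂volume ∂(sampleLaw p n) :=
        lintegral_mono fun X => lintegral_mono fun x => hpt (X, x)
    _ = ∫⁻ z, ENNReal.ofReal (1 / (S.card : ℝ)) *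
          ∑ σ ∈ S, ENNReal.ofReal ((g σ z.1 z.2 - p z.2) ^ 2) ∂((sampleLaw p n).prod volume) := by
        refine (lintegral_prod (fun z : (Fin n → E d) × E d => ENNReal.ofReal (1 / (S.card : ℝ)) *
          ∑ σ ∈ S, ENNReal.ofReal ((g σ z.1 z.2 - p z.2) ^ 2)) ?_).symm
        exact (Finset.aemeasurable_fun_sum _ fun σ hσ =>
          (risk_eq_lintegral_prod hp (hg σ hσ)).1).const_mul _
    _ = ENNReal.ofReal (1 / (S.card : ℝ)) * ∑ σ ∈ S, risk p (g σ) := by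
        rw [lintegral_const_mul' _ _ ENNReal.ofReal_ne_top,
          lintegral_finsetSum' _ fun σ hσ => (risk_eq_lintegral_prod hp (hg σ hσ)).1]
        congr 1
        exact Finset.sum_congr rfl fun σ hσ => ((risk_eq_lintegral_prod hp (hg σ hσ)).2).symm
    _ ≤ ENNReal.ofReal (1 / (S.card : ℝ)) * ∑ σ ∈ S, B := by
        gcongr with σ hσ
        exact hB σ hσ
    _ = B := by
        rw [Finset.sum_const, nsmul_eq_mul, ← mul_assoc, ← ENNReal.ofReal_natCast,
          ← ENNReal.ofReal_mul (by positivity), one_div_mul_cancel hcard.ne', ENNReal.ofReal_one,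
          one_mul]

/-- A split turns an i.i.d. sample into independent training and validation samples. -/
theorem exists_measurePreserving_split (hp : IsBoundedDensity L p) (σ : Split n) :
    ∃ f : (Fin (trainSize n) → E d) × (Fin (n - trainSize n) → E d) ≃ᵐ (Fin n → E d),
      MeasurePreserving f ((sampleLaw p (trainSize n)).prod (sampleLaw p (n - trainSize n)))
        (sampleLaw p n) ∧
      ∀ Z Y, σ.train (f (Z, Y)) = Z ∧ σ.valid (f (Z, Y)) = Y := by
  have hprob := hp.isProbabilityMeasure
  let f₁ := MeasurableEquiv.sumPiEquivProdPi
    (fun _ : Fin (trainSize n) ⊕ Fin (n - trainSize n) => E d)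
  let f₂ := MeasurableEquiv.piCongrLeft (fun _ : Fin n => E d) σ
  have h1 := measurePreserving_sumPiEquivProdPi
    (fun _ : Fin (trainSize n) ⊕ Fin (n - trainSize n) => law p)
  have h2 := measurePreserving_piCongrLeft (fun _ : Fin n => law p) σ
  have hf₂ : ∀ W s, f₂ W (σ s) = W s := fun W s =>
    Equiv.piCongrLeft_apply_apply (fun _ : Fin n => E d) σ W s
  refine ⟨f₁.symm.trans f₂, h2.comp h1.symm, fun Z Y => ⟨?_, ?_⟩⟩
  · ext1 i
    exact hf₂ _ (Sum.inl i)
  · ext1 i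
    exact hf₂ _ (Sum.inr i)

theorem memLp_kernelEstimator (hK : MemLp K 2) {m : ℕ} {h : ℝ} (hh : 0 < h) (X : Fin m → E d) :
    MemLp (kernelEstimator K h X) 2 := by
  have h1 : kernelEstimator K h X = fun x => 1 / (m : ℝ) * ∑ i, dilate K h (X i - x) := by
    ext x
    exact kernelEstimator_eq K h X x
  rw [h1]
  exact (memLp_finsetSum _ fun i _ => memLp_comp_sub_left (memLp_dilate hK hh) (X i)).const_mul _

/-- The risk of an aggregate is at most the risk of each initial estimator, up to the price of
aggregation. -/
theorem risk_aggregate_le (hp : IsBoundedDensity L p) (hL : 0 ≤ L) (hK : MemLp K 2)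
    (hl : n - trainSize n ≠ 0) (hband : ∀ j, 0 < bandwidth d a₀ n j) (σ : Split n)
    {g : (Fin n → E d) → E d → ℝ}
    (hg : (∀ X, IsLinearAggregate (initialEstimators K a₀ σ X) (σ.valid X) (g X)) ∨
      (∀ X, IsConvexAggregate (initialEstimators K a₀ σ X) (σ.valid X) (g X)))
    (j : Fin (gridSize d a₀ n)) :
    risk p g ≤ risk p (fun Z : Fin (trainSize n) → E d => kernelEstimator K (bandwidth d a₀ n j) Z) +
      ENNReal.ofReal (L * gridSize d a₀ n / (n - trainSize n : ℕ)) := by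
  have hprob := hp.isProbabilityMeasure
  have hprob' : IsProbabilityMeasure (sampleLaw p (trainSize n)) := by
    rw [sampleLaw_eq]
    infer_instance
  obtain ⟨f, hf, hsplit⟩ := exists_measurePreserving_split hp σ
  set q : (Fin (trainSize n) → E d) → Fin (gridSize d a₀ n) → E d → ℝ :=
    fun Z j => kernelEstimator K (bandwidth d a₀ n j) Z with hq
  have hinit : ∀ Z Y, initialEstimators K a₀ σ (f (Z, Y)) = q Z := by
    intro Z Y
    ext1 j
    simp only [initialEstimators, (hsplit Z Y).1, hq]
  calc risk p g = ∫⁻ z, ∫⁻ x, ENNReal.ofReal ((g (f z) x - p x) ^ 2) ∂volume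
        ∂((sampleLaw p (trainSize n)).prod (sampleLaw p (n - trainSize n))) :=
        (hf.lintegral_comp_emb f.measurableEmbedding
          (fun X => ∫⁻ x, ENNReal.ofReal ((g X x - p x) ^ 2))).symm
    _ ≤ ∫⁻ Z, ∫⁻ Y, ∫⁻ x, ENNReal.ofReal ((g (f (Z, Y)) x - p x) ^ 2) ∂volume
        -- This half of Tonelli needs no measurability of the integrand.
        ∂(sampleLaw p (n - trainSize n)) ∂(sampleLaw p (trainSize n)) := lintegral_prod_le _
    _ ≤ ∫⁻ Z, ((∫⁻ x, ENNReal.ofReal ((q Z j x - p x) ^ 2)) +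
          ENNReal.ofReal (L * gridSize d a₀ n / (n - trainSize n : ℕ)))
          ∂(sampleLaw p (trainSize n)) := by
        refine lintegral_mono fun Z => ?_
        refine lintegral_aggregate_le hp hL (fun j => memLp_kernelEstimator hK (hband j) Z) hl
          (g := fun Y => g (f (Z, Y))) ?_ j
        rcases hg with hg | hg
        · left
          intro Y
          have := hg (f (Z, Y))
          rwa [hinit, (hsplit Z Y).2] at this
        · right
          intro Y
          have := hg (f (Z, Y))
          rwa [hinit, (hsplit Z Y).2] at this
    _ = _ := by
        rw [lintegral_add_right _ measurable_const, lintegral_const, measure_univ, mul_one]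
        rfl

end

/-! ### Sizes of the split and of the bandwidth grid -/

section

section Grid

variable {d n : ℕ} {a₀ : ℝ}

theorem trainSize_bounds (hn : 4 ≤ Real.log n) :
    (n : ℝ) * (1 - 2 / Real.log n) ≤ trainSize n ∧
      (trainSize n : ℝ) ≤ n * (1 - 1 / Real.log n) ∧ trainSize n ≤ n := by
  set x := Real.log n with hx
  have hx0 : 0 < x := by linarith
  have hn0 : (0 : ℝ) ≤ n := by positivity
  have hxn : x ≤ n := Real.log_le_self hn0
  have h1 : x⁻¹ ≤ 1 := inv_le_one_of_one_le₀ (by linarith)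
  have h2 : (trainSize n : ℝ) ≤ n * (1 - 1 / x) := by
    rw [one_div]
    exact Nat.floor_le (mul_nonneg hn0 (by linarith))
  refine ⟨?_, h2, ?_⟩
  · have h3 := Nat.sub_one_lt_floor ((n : ℝ) * (1 - x⁻¹))
    have h4 : (n : ℝ) * (1 - x⁻¹) - 1 < trainSize n := h3
    -- Rounding down loses at most one observation, absorbed in a second `n / log n`.
    have h5 : 1 ≤ (n : ℝ) / x := (one_le_div hx0).2 hxn
    have h6 : (n : ℝ) * (1 - 2 / x) = (n : ℝ) * (1 - x⁻¹) - n / x := by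
      field_simp
      ring
    linarith
  · have h7 : (n : ℝ) * (1 - 1 / x) ≤ n :=
      mul_le_of_le_one_right hn0 (by rw [one_div]; linarith [inv_pos.2 hx0])
    exact_mod_cast h2.trans h7

theorem div_trainSize_le (hn : 4 ≤ Real.log n) :
    0 < (trainSize n : ℝ) ∧ (n : ℝ) / trainSize n ≤ 1 + 4 / Real.log n := by
  obtain ⟨h1, -, -⟩ := trainSize_bounds hn
  set x := Real.log n with hx
  have hx0 : 0 < x := by linarith
  have hn0 : (0 : ℝ) < n := by
    have := Real.log_le_self (show (0 : ℝ) ≤ n by positivity)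
    linarith
  have h2 : 0 < 1 - 2 / x := by
    rw [sub_pos, div_lt_one hx0]
    linarith
  have hm : 0 < (trainSize n : ℝ) := (mul_pos hn0 h2).trans_le h1
  refine ⟨hm, ?_⟩
  rw [div_le_iff₀ hm]
  have h3 : 1 ≤ (1 + 4 / x) * (1 - 2 / x) := by
    have : (1 + 4 / x) * (1 - 2 / x) = 1 + 2 * (x - 4) / x ^ 2 := by
      field_simp
      ring
    rw [this]
    have : 0 ≤ 2 * (x - 4) / x ^ 2 := div_nonneg (by linarith) (by positivity)
    linarith
  calc (n : ℝ) = n * 1 := (mul_one _).symm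
    _ ≤ n * ((1 + 4 / x) * (1 - 2 / x)) := by gcongr
    _ = (1 + 4 / x) * (n * (1 - 2 / x)) := by ring
    _ ≤ (1 + 4 / x) * trainSize n := by gcongr

theorem div_log_le_validSize (hn : 4 ≤ Real.log n) :
    (n : ℝ) / Real.log n ≤ (n - trainSize n : ℕ) := by
  obtain ⟨-, h1, h2⟩ := trainSize_bounds hn
  rw [Nat.cast_sub h2]
  have : (n : ℝ) * (1 - 1 / Real.log n) = n - n / Real.log n := by ring
  linarith

theorem minBandwidth_pos (hn : 4 ≤ Real.log n) : 0 < minBandwidth d n := by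
  have := Real.log_le_self (show (0 : ℝ) ≤ n by positivity)
  exact Real.rpow_pos_of_pos (mul_pos (by linarith) (by linarith)) _

theorem minBandwidth_pow (hd : 1 ≤ d) (hn : 4 ≤ Real.log n) :
    minBandwidth d n ^ d = (n * Real.log n)⁻¹ := by
  have := Real.log_le_self (show (0 : ℝ) ≤ n by positivity)
  have h0 : 0 ≤ (n : ℝ) * Real.log n := mul_nonneg (by linarith) (by linarith)
  rw [minBandwidth, ← Real.rpow_natCast, ← Real.rpow_mul h0]
  have hd' : (d : ℝ) ≠ 0 := by positivity
  rw [neg_mul, one_div_mul_cancel hd', Real.rpow_neg_one]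

theorem minBandwidth_lt_one (hd : 1 ≤ d) (hn : 4 ≤ Real.log n) : minBandwidth d n < 1 := by
  have := Real.log_le_self (show (0 : ℝ) ≤ n by positivity)
  refine Real.rpow_lt_one_of_one_lt_of_neg (by nlinarith) ?_
  have hd' : (0 : ℝ) < d := by positivity
  rw [neg_lt_zero]
  positivity

theorem gridStep_pos (ha : 0 < a₀) (hn : 4 ≤ Real.log n) : 0 < gridStep a₀ n :=
  div_pos ha (by linarith)

/-- The number of grid points below one grows at most like `log² n`. -/
theorem cast_le_of_grid_lt_one (hd : 1 ≤ d) (ha : 0 < a₀) (hn : 4 ≤ Real.log n) {j : ℕ}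
    (hj : minBandwidth d n * (1 + gridStep a₀ n) ^ j < 1) :
    (j : ℝ) ≤ 2 * (1 + a₀) / a₀ * Real.log n ^ 2 := by
  have hnx := Real.log_le_self (show (0 : ℝ) ≤ n by positivity)
  have ha1 := gridStep_pos ha hn
  have hb := minBandwidth_pos (d := d) hn
  have h1 : Real.log (minBandwidth d n * (1 + gridStep a₀ n) ^ j) < 0 :=
    Real.log_neg (by positivity) hj
  rw [Real.log_mul hb.ne' (by positivity), Real.log_pow, minBandwidth,
    Real.log_rpow (mul_pos (by linarith) (by linarith)),
    Real.log_mul (by linarith) (by linarith)] at h1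
  -- The bound `log (1 + a) ≥ a / (1 + a)` gives a grid spacing of at least `a₀ / (log n + a₀)` on
  -- the logarithmic scale, where the grid spans at most `2 * log n`.
  have h2 := Real.one_sub_inv_le_log_of_pos (show 0 < 1 + gridStep a₀ n by linarith)
  set x := Real.log n with hx
  have hx0 : 0 < x := by linarith
  have h3 : Real.log x ≤ x := Real.log_le_self hx0.le
  have h4 : 1 - (1 + gridStep a₀ n)⁻¹ = a₀ / (x + a₀) := by
    rw [gridStep, ← hx]
    have : x + a₀ ≠ 0 := by positivity
    field_simp
    ring
  rw [h4] at h2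
  have hlx : 0 ≤ Real.log x := Real.log_nonneg (by linarith)
  have hd' : (1 : ℝ) / d ≤ 1 := by
    rw [div_le_one (by positivity)]
    exact_mod_cast hd
  have h5 : 1 / (d : ℝ) * (x + Real.log x) ≤ 2 * x := by
    calc 1 / (d : ℝ) * (x + Real.log x) ≤ 1 * (x + Real.log x) := by gcongr
      _ ≤ 2 * x := by linarith
  have h6 : (j : ℝ) * (a₀ / (x + a₀)) ≤ 2 * x := by
    have := mul_le_mul_of_nonneg_left h2 (show (0 : ℝ) ≤ j by positivity)
    linarith
  have h7 : (j : ℝ) ≤ 2 * x * ((x + a₀) / a₀) := by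
    have e : (j : ℝ) = (j : ℝ) * (a₀ / (x + a₀)) * ((x + a₀) / a₀) := by
      have : x + a₀ ≠ 0 := by positivity
      field_simp
    rw [e]
    gcongr
  refine h7.trans ?_
  have e2 : 2 * (1 + a₀) / a₀ * x ^ 2 = 2 * x * ((x + a₀ * x) / a₀) := by
    field_simp
  rw [e2]
  gcongr
  nlinarith

theorem bddAbove_grid (hd : 1 ≤ d) (ha : 0 < a₀) (hn : 4 ≤ Real.log n) :
    BddAbove {j : ℕ | minBandwidth d n * (1 + gridStep a₀ n) ^ j < 1} := by
  refine ⟨⌊2 * (1 + a₀) / a₀ * Real.log n ^ 2⌋₊, fun j hj => ?_⟩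
  exact Nat.le_floor (cast_le_of_grid_lt_one hd ha hn hj)

theorem gridSize_le (hd : 1 ≤ d) (ha : 0 < a₀) (hn : 4 ≤ Real.log n) :
    (gridSize d a₀ n : ℝ) ≤ (2 * (1 + a₀) / a₀ + 2) * Real.log n ^ 2 := by
  have hmem := Nat.sSup_mem (s := {j : ℕ | minBandwidth d n * (1 + gridStep a₀ n) ^ j < 1})
    ⟨0, by simpa using minBandwidth_lt_one hd hn⟩ (bddAbove_grid hd ha hn)
  have h1 := cast_le_of_grid_lt_one hd ha hn hmem
  rw [gridSize]
  push_cast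
  nlinarith

theorem bandwidth_pos (ha : 0 < a₀) (hn : 4 ≤ Real.log n) (j : Fin (gridSize d a₀ n)) :
    0 < bandwidth d a₀ n j := by
  have h1 := gridStep_pos ha hn
  have h2 := minBandwidth_pos (d := d) hn
  rw [bandwidth]
  split_ifs <;> positivity

theorem exists_bandwidth_eq_one (d : ℕ) (a₀ : ℝ) (n : ℕ) : ∃ j, bandwidth d a₀ n j = 1 := by
  refine ⟨⟨gridSize d a₀ n - 1, by simp [gridSize]⟩, ?_⟩
  rw [bandwidth, if_pos]
  simp [gridSize]

/-- Every bandwidth between `h₀` and `1` is within a factor `1 + a_n` above a grid point. -/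
theorem exists_bandwidth_near (hd : 1 ≤ d) (ha : 0 < a₀) (hn : 4 ≤ Real.log n) {h : ℝ}
    (h0 : minBandwidth d n ≤ h) (h1 : h ≤ 1) :
    ∃ j, bandwidth d a₀ n j ≤ h ∧ h ≤ (1 + gridStep a₀ n) * bandwidth d a₀ n j := by
  set N := sSup {j : ℕ | minBandwidth d n * (1 + gridStep a₀ n) ^ j < 1} with hN
  have hex : ∃ i, h ≤ minBandwidth d n * (1 + gridStep a₀ n) ^ (i + 1) := by
    refine ⟨N, h1.trans (not_lt.1 fun hlt => ?_)⟩
    have := le_csSup (bddAbove_grid hd ha hn) hlt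
    omega
  have hNle : h ≤ minBandwidth d n * (1 + gridStep a₀ n) ^ (N + 1) := by
    refine h1.trans (not_lt.1 fun hlt => ?_)
    have := le_csSup (bddAbove_grid hd ha hn) hlt
    omega
  classical
  -- Minimality puts the `i`-th point at or below `h`; for `i = 0` this is `h₀ ≤ h`. Since `i ≤ N`,
  -- which is the grid size minus two, the index never reaches the exceptional last point.
  set i := Nat.find hex with hi
  have hiN : i ≤ N := Nat.find_min' hex hNle
  have hspec : h ≤ minBandwidth d n * (1 + gridStep a₀ n) ^ (i + 1) := Nat.find_spec hex
  have hlow : minBandwidth d n * (1 + gridStep a₀ n) ^ i ≤ h := by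
    rcases Nat.eq_zero_or_pos i with hz | hpos
    · rw [hz]
      simpa using h0
    · have := Nat.find_min hex (show i - 1 < i by omega)
      rw [Nat.sub_add_cancel hpos] at this
      exact (not_le.1 this).le
  have hband : bandwidth d a₀ n ⟨i, by rw [gridSize]; omega⟩ =
      (1 + gridStep a₀ n) ^ i * minBandwidth d n := by
    rw [bandwidth, if_neg]
    simp only [gridSize]
    omega
  refine ⟨⟨i, by rw [gridSize]; omega⟩, ?_, ?_⟩
  · rw [hband, mul_comm]
    exact hlow
  · rw [hband]
    calc h ≤ _ := hspec
      _ = _ := by ring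

/-- The inflation of the variance term due to the grid and to the smaller training sample. -/
theorem inflation_le (ha : 0 < a₀) (hn : 4 ≤ Real.log n) :
    (1 + gridStep a₀ n) ^ d * ((n : ℝ) / trainSize n) ≤
      1 + 5 * (1 + a₀) ^ d / Real.log n := by
  have h1 := (div_trainSize_le hn).2
  have ha1 := gridStep_pos ha hn
  set x := Real.log n with hx
  have hx0 : 0 < x := by linarith
  have hC : 1 ≤ (1 + a₀) ^ d := one_le_pow₀ (by linarith)
  set C := (1 + a₀) ^ d with hCdef
  have h2 : (1 + gridStep a₀ n) ^ d ≤ 1 + (C - 1) / x := by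
    -- As `1 + a_n` lies between `1` and `1 + a₀` with weight `1 / log n`, convexity of `t ↦ tᵈ`
    -- gives the linear bound at once.
    have hconv := (convexOn_pow (𝕜 := ℝ) d).2 (show (1 : ℝ) ∈ Set.Ici 0 by simp)
      (show 1 + a₀ ∈ Set.Ici (0 : ℝ) by simp; linarith) (show 0 ≤ 1 - x⁻¹ by
        have := inv_le_one_of_one_le₀ (show 1 ≤ x by linarith)
        linarith) (show 0 ≤ x⁻¹ by positivity) (by ring)
    simp only [smul_eq_mul, one_pow, mul_one] at hconv
    have e1 : 1 + gridStep a₀ n = 1 - x⁻¹ + x⁻¹ * (1 + a₀) := by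
      rw [gridStep, ← hx]
      ring
    rw [e1]
    refine hconv.trans (le_of_eq ?_)
    ring
  have h3 : 0 ≤ (C - 1) / x := div_nonneg (by linarith) hx0.le
  calc (1 + gridStep a₀ n) ^ d * ((n : ℝ) / trainSize n)
      ≤ (1 + (C - 1) / x) * (1 + 4 / x) := by gcongr
    _ ≤ 1 + 5 * C / x := by
      have e2 : (1 + (C - 1) / x) * (1 + 4 / x) = 1 + (C - 1) / x + 4 / x + (C - 1) / x * (4 / x) := by
        ring
      have h4 : 4 / x ≤ 4 := div_le_self (by norm_num) (by linarith)
      have h5 : (C - 1) / x * (4 / x) ≤ (C - 1) / x * 4 := mul_le_mul_of_nonneg_left h4 h3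
      have e3 : 1 + 5 * C / x = 1 + (C - 1) / x + 4 / x + (C - 1) / x * 4 + 1 / x := by
        field_simp
        ring
      have h6 : 0 < 1 / x := by positivity
      linarith

end Grid

end

/-! ### A nearly optimal grid bandwidth and the final bound -/

section

variable {d n : ℕ} {L a₀ : ℝ} {p K : E d → ℝ}

/-- The mean integrated squared error of the kernel estimator based on `k` observations. -/
noncomputable def mise (K p : E d → ℝ) (k : ℕ) (h : ℝ) : ℝ :=
  (∫ x, (smooth (dilate K h) p x - p x) ^ 2) +
    1 / (k : ℝ) * (l2Norm K ^ 2 / h ^ d - ∫ x, smooth (dilate K h) p x ^ 2)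

theorem integral_smooth_dilate_sq_le (hp : IsBoundedDensity L p) (hL : 0 ≤ L) (hK : MemLp K 2)
    {h : ℝ} (hh : 0 < h) :
    ∫ x, smooth (dilate K h) p x ^ 2 ≤ l2Norm K ^ 2 / h ^ d := by
  rw [← integral_dilate_sq K hh]
  exact integral_smooth_sq_le hp hL (memLp_dilate hK hh)

theorem integral_bias_sq_le_mise (hp : IsBoundedDensity L p) (hL : 0 ≤ L) (hK : MemLp K 2)
    (k : ℕ) {h : ℝ} (hh : 0 < h) :
    ∫ x, (smooth (dilate K h) p x - p x) ^ 2 ≤ mise K p k h := by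
  have h1 := integral_smooth_dilate_sq_le hp hL hK hh
  have h2 : 0 ≤ 1 / (k : ℝ) * (l2Norm K ^ 2 / h ^ d - ∫ x, smooth (dilate K h) p x ^ 2) :=
    mul_nonneg (by positivity) (by linarith)
  rw [mise]
  linarith

theorem mise_one_le {k : ℕ} :
    mise K p k 1 ≤ (∫ x, (smooth (dilate K 1) p x - p x) ^ 2) + l2Norm K ^ 2 / k := by
  have h1 : 0 ≤ ∫ x, smooth (dilate K 1) p x ^ 2 := integral_nonneg fun x => sq_nonneg _
  have h2 : 0 ≤ 1 / (k : ℝ) * ∫ x, smooth (dilate K 1) p x ^ 2 := mul_nonneg (by positivity) h1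
  rw [mise, one_pow, div_one, mul_sub, one_div_mul_eq_div]
  linarith

/-- For a vanishing kernel the risk does not depend on the bandwidth or on the sample size. -/
theorem mise_eq_of_l2Norm_eq_zero (hp : IsBoundedDensity L p) (hL : 0 ≤ L) (hK : MemLp K 2)
    (h0 : l2Norm K = 0) (k : ℕ) {h : ℝ} (hh : 0 < h) : mise K p k h = ∫ x, p x ^ 2 := by
  have h1 := integral_smooth_dilate_sq_le hp hL hK hh
  have h2 : ∫ x, smooth (dilate K h) p x ^ 2 = 0 := by
    refine le_antisymm ?_ (integral_nonneg fun x => sq_nonneg _)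
    simpa [h0] using h1
  have h3 := (integral_eq_zero_iff_of_nonneg (fun x => sq_nonneg (smooth (dilate K h) p x))
    (memLp_smooth hp hL (memLp_dilate hK hh)).integrable_sq).1 h2
  rw [mise, h2, h0]
  simp only [ne_eq, OfNat.ofNat_ne_zero, not_false_eq_true, zero_pow, zero_div, sub_zero, mul_zero,
    add_zero]
  apply integral_congr_ae
  filter_upwards [h3] with x hx
  have hx' : smooth (dilate K h) p x = 0 := by simpa using hx
  simp [hx']

/-- Some bandwidth of the grid is nearly as good for the training sample as `h` is for the full
sample. -/
theorem exists_mise_bandwidth_le (hp : IsBoundedDensity L p) (hL : 0 < L) (hK : MemLp K 2)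
    (hF : HasMonotoneFourier K hK) (hd : 1 ≤ d) (ha : 0 < a₀) (hn : 4 ≤ Real.log n)
    (hn2 : l2Norm K ≠ 0 → 1 + 2 * L / l2Norm K ^ 2 ≤ Real.log n) {h : ℝ} (hh : 0 < h) :
    ∃ j, mise K p (trainSize n) (bandwidth d a₀ n j) ≤
      (1 + 5 * (1 + a₀) ^ d / Real.log n) * mise K p n h +
        (5 * (1 + a₀) ^ d * L + 2 * l2Norm K ^ 2) / n := by
  obtain ⟨hm0, hm⟩ := div_trainSize_le hn
  have hinf := inflation_le (d := d) ha hn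
  have hnx := Real.log_le_self (show (0 : ℝ) ≤ n by positivity)
  have hmn : (trainSize n : ℝ) ≤ n := by exact_mod_cast (trainSize_bounds hn).2.2
  have hsL := fun {t : ℝ} (ht : 0 < t) => (integral_smooth_sq_le_density hp hL.le hK hF ht).trans
    (hp.integral_sq_le hL.le)
  set x := Real.log n with hx
  have hx0 : 0 < x := by linarith
  have hn0 : (0 : ℝ) < n := by linarith
  set C := 5 * (1 + a₀) ^ d with hC
  have hC0 : 0 < C := by positivity
  set κ := l2Norm K with hκ
  have hbias := integral_bias_sq_le_mise hp hL.le hK n hh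
  have hb0 : 0 ≤ ∫ x, (smooth (dilate K h) p x - p x) ^ 2 := integral_nonneg fun x => sq_nonneg _
  have hmise0 : 0 ≤ mise K p n h := hb0.trans hbias
  have herr : 0 ≤ (C * L + 2 * κ ^ 2) / n := by positivity
  have hle : mise K p n h ≤ (1 + C / x) * mise K p n h := by
    have : 0 ≤ C / x * mise K p n h := by positivity
    linarith
  obtain ⟨j₁, hj₁⟩ := exists_bandwidth_eq_one d a₀ n
  by_cases hκ0 : κ = 0
  · refine ⟨j₁, ?_⟩
    rw [hj₁, mise_eq_of_l2Norm_eq_zero hp hL.le hK hκ0 _ one_pos,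
      ← mise_eq_of_l2Norm_eq_zero hp hL.le hK hκ0 n hh]
    linarith
  have hκm : κ ^ 2 / trainSize n ≤ 2 * κ ^ 2 / n := by
    have h1 : (n : ℝ) / trainSize n ≤ 2 := by
      have : 4 / x ≤ 1 := (div_le_one hx0).2 hn
      linarith
    calc κ ^ 2 / trainSize n = κ ^ 2 / n * (n / trainSize n) := by field_simp
      _ ≤ κ ^ 2 / n * 2 := by gcongr
      _ = _ := by ring
  -- Below `h₀` the risk at `h` is at least `κ² log n - L`, while bandwidth `1` costs at most `L +
  -- κ²`; the hypothesis `hn2` is what orders the two.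
  rcases lt_or_ge h (minBandwidth d n) with hlt | hge
  · refine ⟨j₁, ?_⟩
    rw [hj₁]
    have h1 := mise_one_le (K := K) (p := p) (k := trainSize n)
    have h2 := (integral_bias_sq_le_density hp hL.le hK hF one_pos).trans (hp.integral_sq_le hL.le)
    have h3 : x * κ ^ 2 - L ≤ mise K p n h := by
      have e1 : h ^ d ≤ (n * x)⁻¹ := by
        rw [hx, ← minBandwidth_pow hd hn]
        exact pow_le_pow_left₀ hh.le hlt.le d
      have e2 : n * x * κ ^ 2 ≤ κ ^ 2 / h ^ d := by
        rw [le_div_iff₀ (by positivity)]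
        have e3 : n * x * h ^ d ≤ 1 := by
          have := mul_le_mul_of_nonneg_left e1 (show 0 ≤ n * x by positivity)
          rwa [mul_inv_cancel₀ (by positivity)] at this
        nlinarith [sq_nonneg κ]
      have e4 : 1 / (n : ℝ) * (n * x * κ ^ 2 - L) ≤
          1 / (n : ℝ) * (κ ^ 2 / h ^ d - ∫ x, smooth (dilate K h) p x ^ 2) :=
        mul_le_mul_of_nonneg_left (by linarith [hsL hh]) (by positivity)
      have e5 : 1 / (n : ℝ) * (n * x * κ ^ 2 - L) = x * κ ^ 2 - L / n := by field_simp
      have e6 : L / n ≤ L := div_le_self hL.le (by linarith)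
      rw [mise]
      linarith
    have h4 := hn2 hκ0
    have hκpos : 0 < κ ^ 2 := by positivity
    have h5 : κ ^ 2 + 2 * L ≤ x * κ ^ 2 := by
      have := mul_le_mul_of_nonneg_right h4 hκpos.le
      rwa [add_mul, one_mul, div_mul_cancel₀ _ hκpos.ne'] at this
    have h6 : κ ^ 2 / trainSize n ≤ κ ^ 2 := by
      refine div_le_self hκpos.le ?_
      have : 0 < trainSize n := by exact_mod_cast hm0
      exact_mod_cast this
    linarith
  rcases le_or_gt h 1 with hle1 | hgt1
  · obtain ⟨j, hj1, hj2⟩ := exists_bandwidth_near hd ha hn hge hle1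
    refine ⟨j, ?_⟩
    have hjpos := bandwidth_pos (d := d) ha hn j
    set t := bandwidth d a₀ n j with ht
    have hb := integral_bias_sq_mono hp hL.le hK hF hjpos hj1
    have hs := integral_smooth_sq_anti hp hL.le hK hF hjpos hj1
    have hsh := hsL hh
    have hs0 : 0 ≤ ∫ x, smooth (dilate K h) p x ^ 2 := integral_nonneg fun x => sq_nonneg _
    have hV := integral_smooth_dilate_sq_le hp hL.le hK hh
    rw [mise, mise]
    set b := ∫ x, (smooth (dilate K h) p x - p x) ^ 2
    set s := ∫ x, smooth (dilate K h) p x ^ 2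
    set r := (1 + gridStep a₀ n) ^ d * ((n : ℝ) / trainSize n) with hr
    have ha1 := gridStep_pos ha hn
    have h1 : κ ^ 2 / t ^ d ≤ (1 + gridStep a₀ n) ^ d * (κ ^ 2 / h ^ d) := by
      have e1 : h ^ d ≤ (1 + gridStep a₀ n) ^ d * t ^ d := by
        rw [← mul_pow]
        exact pow_le_pow_left₀ hh.le hj2 d
      rw [div_le_iff₀ (by positivity)]
      calc κ ^ 2 = κ ^ 2 / h ^ d * h ^ d := by field_simp
        _ ≤ κ ^ 2 / h ^ d * ((1 + gridStep a₀ n) ^ d * t ^ d) := by gcongr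
        _ = _ := by ring
    have h2 : 1 / (trainSize n : ℝ) * (κ ^ 2 / t ^ d - ∫ x, smooth (dilate K t) p x ^ 2) ≤
        1 / (trainSize n : ℝ) * ((1 + gridStep a₀ n) ^ d * (κ ^ 2 / h ^ d) - s) :=
      mul_le_mul_of_nonneg_left (by linarith) (by positivity)
    have h3 : 1 / (trainSize n : ℝ) * ((1 + gridStep a₀ n) ^ d * (κ ^ 2 / h ^ d) - s) =
        r * (1 / n * (κ ^ 2 / h ^ d)) - 1 / (trainSize n : ℝ) * s := by
      rw [hr]
      field_simp
    -- The subtracted term `s` is not inflated like the variance. The mismatch `(C / x) * s / n` is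
    -- at most `C * L / n` and goes into the remainder.
    have h4 : 1 / (n : ℝ) * s ≤ 1 / (trainSize n : ℝ) * s := by gcongr
    have hV0 : 0 ≤ 1 / (n : ℝ) * (κ ^ 2 / h ^ d) := by positivity
    have h5 : r * (1 / n * (κ ^ 2 / h ^ d)) ≤ (1 + C / x) * (1 / n * (κ ^ 2 / h ^ d)) :=
      mul_le_mul_of_nonneg_right hinf hV0
    have h6 : C / x * (1 / n * s) ≤ C * L / n := by
      have : C / x ≤ C := div_le_self hC0.le (by linarith)
      calc C / x * (1 / n * s) ≤ C * (1 / n * L) := by gcongr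
        _ = _ := by ring
    have h7 : 0 ≤ C / x * b := by positivity
    have h8 : 0 ≤ 2 * κ ^ 2 / n := by positivity
    rw [add_div]
    nlinarith
  · refine ⟨j₁, ?_⟩
    rw [hj₁]
    have h1 := mise_one_le (K := K) (p := p) (k := trainSize n)
    have h2 := integral_bias_sq_mono hp hL.le hK hF one_pos hgt1.le
    have h3 : 0 ≤ C * L / n := by positivity
    rw [add_div]
    linarith

/-- The price of aggregation. -/
theorem aggregation_price_le (hL : 0 ≤ L) (hd : 1 ≤ d) (ha : 0 < a₀) (hn : 4 ≤ Real.log n) :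
    L * gridSize d a₀ n / (n - trainSize n : ℕ) ≤
      L * (2 * (1 + a₀) / a₀ + 2) * (Real.log n ^ 3 / n) := by
  have h1 := gridSize_le hd ha hn
  have h2 := div_log_le_validSize hn
  have hnx := Real.log_le_self (show (0 : ℝ) ≤ n by positivity)
  set x := Real.log n with hx
  have hx0 : 0 < x := by linarith
  have hn0 : (0 : ℝ) < n := by linarith
  calc L * gridSize d a₀ n / (n - trainSize n : ℕ)
      ≤ L * ((2 * (1 + a₀) / a₀ + 2) * x ^ 2) / (n / x) := by gcongr
    _ = _ := by field_simp

theorem risk_averaged_aggregates_le (hp : IsBoundedDensity L p) (hL : 0 < L) (hK : MemLp K 2)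
    (hF : HasMonotoneFourier K hK) (hd : 1 ≤ d) (ha : 0 < a₀) (hn : 4 ≤ Real.log n)
    (hn2 : l2Norm K ≠ 0 → 1 + 2 * L / l2Norm K ^ 2 ≤ Real.log n)
    {S : Finset (Split n)} (hS : S.Nonempty) {g : Split n → (Fin n → E d) → E d → ℝ}
    (hgm : ∀ σ ∈ S, AEMeasurable (Function.uncurry (g σ)) ((sampleLaw p n).prod volume))
    (hg : (∀ σ ∈ S, ∀ X, IsLinearAggregate (initialEstimators K a₀ σ X) (σ.valid X) (g σ X)) ∨
      (∀ σ ∈ S, ∀ X, IsConvexAggregate (initialEstimators K a₀ σ X) (σ.valid X) (g σ X)))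
    {h : ℝ} (hh : 0 < h) :
    risk p (averaged S g) ≤
      ENNReal.ofReal (1 + 5 * (1 + a₀) ^ d / Real.log n) *
          risk p (fun X : Fin n → E d => kernelEstimator K h X) +
        ENNReal.ofReal ((5 * (1 + a₀) ^ d * L + 2 * l2Norm K ^ 2 +
          L * (2 * (1 + a₀) / a₀ + 2)) * (Real.log n ^ 3 / n)) := by
  obtain ⟨j, hj⟩ := exists_mise_bandwidth_le hp hL hK hF hd ha hn hn2 hh
  have hm0 := (div_trainSize_le hn).1
  have hnx := Real.log_le_self (show (0 : ℝ) ≤ n by positivity)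
  have hn0 : (0 : ℝ) < n := by linarith
  have hv : (0 : ℝ) < (n - trainSize n : ℕ) :=
    (div_pos hn0 (by linarith)).trans_le (div_log_le_validSize hn)
  have hprice := aggregation_price_le hL.le hd ha hn
  have hjpos := bandwidth_pos (d := d) ha hn j
  have hmise : 0 ≤ mise K p n h :=
    (integral_nonneg fun x => sq_nonneg _).trans (integral_bias_sq_le_mise hp hL.le hK n hh)
  have hmise' : 0 ≤ mise K p (trainSize n) (bandwidth d a₀ n j) :=
    (integral_nonneg fun x => sq_nonneg _).trans (integral_bias_sq_le_mise hp hL.le hK _ hjpos)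
  refine risk_averaged_le hp hS hgm fun σ hσ => ?_
  have hagg := risk_aggregate_le hp hL.le hK (Nat.cast_ne_zero.1 hv.ne')
    (fun j => bandwidth_pos ha hn j) σ
    (hg.imp (fun hg => hg σ hσ) (fun hg => hg σ hσ)) j
  refine hagg.trans ?_
  rw [risk_kernelEstimator hp hL.le hK (Nat.cast_ne_zero.1 hm0.ne') hjpos,
    risk_kernelEstimator hp hL.le hK (Nat.cast_ne_zero.1 hn0.ne') hh]
  change ENNReal.ofReal (mise K p (trainSize n) (bandwidth d a₀ n j)) + _ ≤
    _ * ENNReal.ofReal (mise K p n h) + _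
  set x := Real.log n with hx
  have hx0 : 0 < x := by linarith
  rw [← ENNReal.ofReal_mul (by positivity), ← ENNReal.ofReal_add hmise' (by positivity),
    ← ENNReal.ofReal_add (by positivity) (by positivity)]
  apply ENNReal.ofReal_le_ofReal
  have h1 : (5 * (1 + a₀) ^ d * L + 2 * l2Norm K ^ 2) / n ≤
      (5 * (1 + a₀) ^ d * L + 2 * l2Norm K ^ 2) * (x ^ 3 / n) := by
    rw [div_eq_mul_one_div]
    have : 1 ≤ x ^ 3 := one_le_pow₀ (by linarith)
    gcongr
  rw [add_mul]
  linarith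

end

end KernelAggregation

/-- `n₀` depends only on `L` and `‖K‖`; `c₅` only on `d` and `a₀`; `c₆` only on `L`, `‖K‖`, `d`
and `a₀`. For each split `σ` of the family `S`, the estimator `g σ` is the linear (for all splits)
or the convex (for all splits) aggregate of that split. -/
theorem theorem5p1 :
    ∃ (n₀ : ℝ → ℝ → ℕ) (c₅ : ℕ → ℝ → ℝ) (c₆ : ℝ → ℝ → ℕ → ℝ → ℝ),
      (∀ L κ : ℝ, 4 ≤ n₀ L κ) ∧
      (∀ (d : ℕ) (a₀ : ℝ), 0 < c₅ d a₀) ∧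
      (∀ (L κ : ℝ) (d : ℕ) (a₀ : ℝ), 0 < c₆ L κ d a₀) ∧
      ∀ (d : ℕ) (a₀ L : ℝ), 1 ≤ d → 0 < a₀ → 0 < L →
      ∀ (p : E d → ℝ), IsBoundedDensity L p →
      ∀ (K : E d → ℝ) (hK : MemLp K 2 MeasureTheory.volume), HasMonotoneFourier K hK →
      ∀ n : ℕ, n₀ L (l2Norm K) ≤ n →
      ∀ S : Finset (Split n), S.Nonempty →
      ∀ g : Split n → (Fin n → E d) → E d → ℝ,
        (∀ σ ∈ S, AEMeasurable (Function.uncurry (g σ))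
          ((sampleLaw p n).prod MeasureTheory.volume)) →
        ((∀ σ ∈ S, ∀ X, IsLinearAggregate (initialEstimators K a₀ σ X) (σ.valid X) (g σ X)) ∨
          (∀ σ ∈ S, ∀ X, IsConvexAggregate (initialEstimators K a₀ σ X) (σ.valid X) (g σ X))) →
        risk p (averaged S g) ≤
          ENNReal.ofReal (1 + c₅ d a₀ * (Real.log n)⁻¹) *
              (⨅ (h : ℝ) (_ : 0 < h), risk p (fun X : Fin n → E d => kernelEstimator K h X)) +
            ENNReal.ofReal (c₆ L (l2Norm K) d a₀ * (Real.log n ^ 3 / n)) := by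
  -- The exponential forces `log n ≥ 4` and `log n ≥ 1 + 2L / κ²`; for `κ = 0` the quotient is zero
  -- by convention and only the first matters. Absolute values and the final `+ 1` keep the
  -- constants positive for all real arguments.
  refine ⟨fun L κ => max 4 ⌈Real.exp (4 + 2 * L / κ ^ 2)⌉₊,
    fun d a₀ => 5 * (1 + |a₀|) ^ d,
    fun L κ d a₀ => 5 * (1 + |a₀|) ^ d * |L| + 2 * κ ^ 2 + |L| * (2 * (1 + |a₀|) / |a₀| + 2) + 1,
    fun L κ => le_max_left _ _, fun d a₀ => by positivity,
    fun L κ d a₀ => by positivity, ?_⟩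
  intro d a₀ L hd ha hL p hp K hK hF n hn S hS g hgm hg
  simp only [abs_of_pos ha, abs_of_pos hL]
  have hlog : 4 + 2 * L / l2Norm K ^ 2 ≤ Real.log n := by
    rw [Real.le_log_iff_exp_le]
    · exact (Nat.le_ceil _).trans
        (by exact_mod_cast (le_max_right _ _).trans hn)
    · exact_mod_cast (show 0 < 4 by norm_num).trans_le
        ((le_max_left _ _).trans hn)
  have hκ : 0 ≤ 2 * L / l2Norm K ^ 2 := by positivity
  have hn4 : 4 ≤ Real.log n := by linarith
  have hnx := Real.log_le_self (show (0 : ℝ) ≤ n by positivity)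
  have hle : ∀ h : ℝ, 0 < h → risk p (averaged S g) ≤
      ENNReal.ofReal (1 + 5 * (1 + a₀) ^ d * (Real.log n)⁻¹) *
          risk p (fun X : Fin n → E d => kernelEstimator K h X) +
        ENNReal.ofReal ((5 * (1 + a₀) ^ d * L + 2 * l2Norm K ^ 2 +
          L * (2 * (1 + a₀) / a₀ + 2) + 1) * (Real.log n ^ 3 / n)) := by
    intro h hh
    refine (risk_averaged_aggregates_le hp hL hK hF hd ha hn4 (fun _ => by linarith) hS hgm hg
      hh).trans ?_
    rw [← div_eq_mul_inv]
    refine add_le_add_right (ENNReal.ofReal_le_ofReal (mul_le_mul_of_nonneg_right ?_ ?_)) _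
    · linarith
    · have : 0 ≤ Real.log n ^ 3 := pow_nonneg (by linarith) 3
      positivity
  have hne : ENNReal.ofReal (1 + 5 * (1 + a₀) ^ d * (Real.log n)⁻¹) ≠ 0 := by
    have : 0 < (Real.log n)⁻¹ := inv_pos.2 (by linarith)
    rw [Ne, ENNReal.ofReal_eq_zero, not_le]
    positivity
  -- The constants are independent of `h`, so the infimum may be taken after the bound for each `h`.
  rw [ENNReal.mul_iInf_of_ne hne ENNReal.ofReal_ne_top, ENNReal.iInf_add]
  refine le_iInf fun h => ?_
  rw [ENNReal.mul_iInf_of_ne hne ENNReal.ofReal_ne_top, ENNReal.iInf_add]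
  exact le_iInf fun hh => hle h hh
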